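/- Let $n\ge 2$, let $\Omega\subset\mathbb R^n$ be a smooth bounded domain (non-empty, open, connected), and let $f\in C^2(\Omega\times\mathbb R)$ with $f\ge 0$. Let $u\in C^4(\Omega)\cap C^2(\overline\Omega)$ satisfy $\Delta u=f(x,u)$ in $\Omega$. Here $C^2(\overline\Omega)$ means that $u$ is $C^2$ in $\Omega$ and that $u,\nabla u,D^2u$ extend continuously to $\overline\Omega$; on $\partial\Omega$ these symbols denote the extensions. For a point where $\nabla u\ne 0$, the shape operator of the level set of $u$ with respect to the normal $\nabla u$ is the operator $S v=-\frac1{|\nabla u|}(D^2u\,v)^{T}$ on the tangent space $(\nabla u)^\perp$, where $(\cdot)^T$ is orthogonal projection to $(\nabla u)^\perp$; equivalently, in $\Omega$, $Sv=-\bigl(D_v\tfrac{\nabla u}{|\nabla u|}\bigr)^T$. The Gaussian curvature is $K=\det S$, the product of the principal curvatures. Assume that $\nabla u\neq 0$ in $\Omega$ and that the level sets are strictly convex with respect to $\nabla u$, i.e. $\langle Sv,v\rangle>0$ for all $0\ne v\perp\nabla u(x)$ and all $x\in\Omega$. We say that a function $\psi$ formed from $\nabla u$ and $K$, which is defined at the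 points of $\overline\Omega$ where $\nabla u\ne0$, *attains its minimum on the boundary* if there is $x_0\in\partial\Omega$ such that $\liminf_{x\to x_0,\,x\in\Omega}\psi(x)\le\psi(y)$ for all $y\in\Omega$, and, if $\nabla u(x_0)\neq0$, also $\psi(x_0)\le\psi(y)$ for all $y\in\overline\Omega$ with $\nabla u(y)\ne 0$. (If $\nabla u\ne0$ on $\overline\Omega$, this says that $\min_{\overline\Omega}\psi$ is attained at a point of $\partial\Omega$.) Then the following hold. (ia) If $f=f(u)$ does not depend on $x$ and $f_u\ge0$ on $\mathbb R$, then $|\nabla u|^{-2}K$ attains its minimum on the boundary. (ib) If $f=f(u)$ does not depend on $x$ and $f_u\le0$ on $\mathbb R$, then $|\nabla u|^{n-1}K$ attains its minimum on the boundary. (ii) If $f=f(x)$ does not depend on $u$ and $t^3f(x)$ is jointly convex in $(x,t)\in\Omega\times(0,\infty)$, meaning convex on $C\times(0,\infty)$ for every convex $C\subseteq\Omega$, then $|\nabla u|^{n-1}K$ attains its minimum on the boundary. Moreover, if $f=f(x)>0$ in $\Omega$, this convexity condition holds if and only if $f^{-1/2}$ is concave on every convex $C\subseteq\Omega$. -/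

import Mathlib

open Set Filter Topology
open scoped Gradient Laplacian InnerProductSpace ContDiff

noncomputable section

/-- `ℝⁿ` with its Euclidean structure. -/
abbrev Eucl (n : ℕ) : Type := EuclideanSpace ℝ (Fin n)

/-- A smooth bounded domain: non-empty, open, connected and bounded, and near each boundary point
it is the sublevel set `{φ < 0}` of a smooth function `φ` with non-vanishing gradient there. -/
structure IsSmoothBoundedDomain {n : ℕ} (Ω : Set (Eucl n)) : Prop where
  isOpen : IsOpen Ω
  isConnected : IsConnected Ω
  isBounded : Bornology.IsBounded Ω
  smooth_frontier : ∀ x₀ ∈ frontier Ω, ∃ (U : Set (Eucl n)) (φ : Eucl n → ℝ),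
    IsOpen U ∧ x₀ ∈ U ∧ ContDiffOn ℝ ∞ φ U ∧ ∇ φ x₀ ≠ 0 ∧ Ω ∩ U = {x ∈ U | φ x < 0}

/-- The Hessian of `u` at `x`, as the operator `v ↦ D_v (∇u)`. -/
def hessian {n : ℕ} (u : Eucl n → ℝ) (x : Eucl n) : Eucl n →L[ℝ] Eucl n :=
  fderiv ℝ (∇ u) x

/-- `u ∈ C²(Ω̄)`: `u` is `C²` in the open set `Ω`, and `u` and its derivatives of order one and two
in `Ω` extend continuously to the closure of `Ω`. -/
structure IsC2UpToBoundary {n : ℕ} (Ω : Set (Eucl n)) (u : Eucl n → ℝ) : Prop where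
  contDiffOn : ContDiffOn ℝ 2 u Ω
  continuousOn : ContinuousOn u (closure Ω)
  gradient_extends : ∃ p : Eucl n → Eucl n, ContinuousOn p (closure Ω) ∧ EqOn p (∇ u) Ω
  hessian_extends : ∃ A : Eucl n → (Eucl n →L[ℝ] Eucl n),
    ContinuousOn A (closure Ω) ∧ EqOn A (hessian u) Ω

/-- `∇u` on `Ω̄`: at each point the limit of `∇u` from inside `Ω`. -/
def gradientBar {n : ℕ} (Ω : Set (Eucl n)) (u : Eucl n → ℝ) : Eucl n → Eucl n :=
  extendFrom Ω (∇ u)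

/-- `D²u` on `Ω̄`: at each point the limit of `D²u` from inside `Ω`. -/
def hessianBar {n : ℕ} (Ω : Set (Eucl n)) (u : Eucl n → ℝ) :
    Eucl n → (Eucl n →L[ℝ] Eucl n) :=
  extendFrom Ω (hessian u)

/-- At points of `Ω` the extended derivatives are the derivatives themselves. -/
theorem gradientBar_hessianBar_eq {n : ℕ} {Ω : Set (Eucl n)} {u : Eucl n → ℝ} (ho : IsOpen Ω)
    (hu : ContDiffOn ℝ 2 u Ω) {x : Eucl n} (hx : x ∈ Ω) :
    gradientBar Ω u x = ∇ u x ∧ hessianBar Ω u x = hessian u x := by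
  have h1 : ContDiffOn ℝ 1 (∇ u) Ω := by
    have := hu.fderiv_of_isOpen (m := 1) ho (by norm_num)
    exact (InnerProductSpace.toDual ℝ (Eucl n)).symm.contDiff.comp_contDiffOn this
  have h2 := h1.continuousOn_fderiv_of_isOpen ho (by norm_num)
  exact ⟨extendFrom_extends h1.continuousOn x hx, extendFrom_extends h2 x hx⟩

/-- The shape operator (Weingarten map), with respect to the normal `∇u`, of the level set of a
function with gradient `p ≠ 0` and Hessian `A` at a point. It acts on the tangent space `p^⊥` of the
level set and is the tangential part of `v ↦ - D_v (∇u / |∇u|)`, which is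
`v ↦ - (A v)^T / |p|`. Its eigenvalues are the principal curvatures. -/
def shapeOperator {n : ℕ} (p : Eucl n) (A : Eucl n →L[ℝ] Eucl n) :
    (ℝ ∙ p)ᗮ →ₗ[ℝ] (ℝ ∙ p)ᗮ :=
  -(‖p‖⁻¹ • ((ℝ ∙ p)ᗮ.orthogonalProjectionOnto ∘L A ∘L (ℝ ∙ p)ᗮ.subtypeL).toLinearMap)

/-- The shape operator is the tangential part of `v ↦ - D_v (∇u / |∇u|)`. -/
theorem shapeOperator_eq {n : ℕ} (u : Eucl n → ℝ) (x : Eucl n) (hx : ∇ u x ≠ 0)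
    (hd : DifferentiableAt ℝ (∇ u) x) (v : (ℝ ∙ (∇ u x))ᗮ) :
    shapeOperator (∇ u x) (hessian u x) v =
      -(ℝ ∙ (∇ u x))ᗮ.orthogonalProjectionOnto
        (fderiv ℝ (fun y => ‖∇ u y‖⁻¹ • ∇ u y) x v) := by
  have hn : DifferentiableAt ℝ (fun y => ‖∇ u y‖⁻¹) x :=
    (hd.norm ℝ hx).inv (by simpa using hx)
  have hp : (ℝ ∙ (∇ u x))ᗮ.orthogonalProjectionOnto (∇ u x) = 0 :=
    Submodule.orthogonalProjectionOnto_orthogonalComplement_singleton_eq_zero _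
  rw [fderiv_fun_smul hn hd]
  simp [shapeOperator, hessian, hp]

/-- The level set through the point is strictly convex there with respect to the normal `p`:
its second fundamental form `⟨S v, v⟩` is positive definite. -/
def IsStrictlyConvexLevel {n : ℕ} (p : Eucl n) (A : Eucl n →L[ℝ] Eucl n) : Prop :=
  ∀ v : (ℝ ∙ p)ᗮ, v ≠ 0 → 0 < ⟪shapeOperator p A v, v⟫_ℝ

/-- The Gaussian curvature `K` (the product of the principal curvatures) of the level set of `u`
through a point `x` of `Ω̄`. -/
def levelCurvature {n : ℕ} (Ω : Set (Eucl n)) (u : Eucl n → ℝ) (x : Eucl n) : ℝ :=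
  LinearMap.det (shapeOperator (gradientBar Ω u x) (hessianBar Ω u x))

/-- A function `ψ`, built from `∇u` and the curvature of the level sets of `u`, attains its minimum
over `Ω̄` on the boundary, at `x₀` say. Such a function has a value only where `∇u ≠ 0`, which is
the case in `Ω` but may fail at points of the boundary. Therefore the first clause says that the
lower limit of `ψ` at `x₀` from inside `Ω` is at most every value of `ψ` in `Ω`, and the second one
that, if `∇u (x₀) ≠ 0`, the value `ψ x₀` is the least of all values of `ψ` in `Ω̄`. -/
def AttainsMinOnBoundary {n : ℕ} (Ω : Set (Eucl n)) (u : Eucl n → ℝ) (ψ : Eucl n → ℝ) : Prop :=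
  ∃ x₀ ∈ frontier Ω,
    (∀ y ∈ Ω, ∀ ε > 0, ∃ᶠ x in 𝓝[Ω] x₀, ψ x < ψ y + ε) ∧
    (gradientBar Ω u x₀ ≠ 0 → ∀ y ∈ closure Ω, gradientBar Ω u y ≠ 0 → ψ x₀ ≤ ψ y)

/-- `t³ h(x)` is convex in `(x, t) ∈ Ω × (0, ∞)`. As `Ω` need not be convex, this means convexity
on `C × (0, ∞)` for each convex `C ⊆ Ω`. -/
def IsCubicallyConvexOn {n : ℕ} (Ω : Set (Eucl n)) (h : Eucl n → ℝ) : Prop :=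
  ∀ C ⊆ Ω, Convex ℝ C → ConvexOn ℝ (C ×ˢ Ioi (0 : ℝ)) (fun q : Eucl n × ℝ => q.2 ^ 3 * h q.1)

/-- `h^{-1/2}` is concave in `Ω`, that is, on each convex `C ⊆ Ω`. -/
def IsConcaveInvSqrtOn {n : ℕ} (Ω : Set (Eucl n)) (h : Eucl n → ℝ) : Prop :=
  ∀ C ⊆ Ω, Convex ℝ C → ConcaveOn ℝ C (fun x => h x ^ (-(1 / 2) : ℝ))

end

/-! Put N = n - 1. All three cases concern ψ = |∇u|^(N+β) K with β = -(N+2) or β = 0. It is enough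
that ψ has no local minimum in Ω. A minimizing sequence then accumulates only on ∂Ω, and continuity
of ψ up to the boundary points with ∇u ≠ 0 gives the rest.

The curvature becomes computable through the bordered Hessian B, the matrix D²u bordered by ∇u and a
zero corner. Its determinant is ±|∇u|^(N+2) K (`det_formMatrix_borderedForm`), so log ψ is log |det
B| + (β-2) log |∇u| up to a constant. B is linear in u and commutes with constant directional
derivatives. Hence log |det B| has the derivatives tr(B⁻¹B_v) and tr(B⁻¹B_vv) - tr((B⁻¹B_v)²), where
B_v is the bordered Hessian of ∂_v u. A constant change of frame of ℝⁿ × ℝ only adds a constant to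
the logarithm. So at a given point the frame may be chosen to make B the direct sum of diag(-l_i)
and an antidiagonal 2 × 2 block.

At a local minimum the second order conditions are added over an orthonormal frame of principal
directions and the normal (`not_isLocalMin_log_bordered`). The fourth derivatives of u combine to
tr(B⁻¹ B(Δu)), which involves only the right-hand side F = Δu. The third derivatives enter
quadratically. Those with three tangential indices are handled by completing squares. For those with
two tangential indices and one normal, the first order condition in the normal direction fixes a
weighted trace, and Cauchy-Schwarz applies. What remains is a scalar inequality in H = ∑ l_i, ∑ l_i²
and F (`curvature_scalar_neg`). It is strict, so no strong maximum principle is needed.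

The terms in F have the right sign under `SourceCondition`. For F = f(u) this reduces to a sign of
(N+β) f'. For F = f(x) and β = 0 it is the second order form of the convexity of t³ f(x). -/

/-! ### Algebraic inequalities for the third derivatives -/

/-- Completing the square: the weighted sum of squares of t_ijk + (2/g)(δ_ik l_i w_j + δ_jk l_j w_i)
is nonnegative. By the symmetry of t both cross terms are the same contraction of t with w. -/
theorem sum_weighted_sq_cubic_ge {ι : Type*} [Fintype ι] [DecidableEq ι] {l w : ι → ℝ} {g : ℝ}
    {t : ι → ι → ι → ℝ} (hl : ∀ i, 0 < l i) (hg : 0 < g)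
    (h12 : ∀ i j k, t i j k = t j i k) (h23 : ∀ i j k, t i j k = t i k j) :
    -(8 / g ^ 2) * ((∑ i, l i) * (∑ i, w i ^ 2 / l i) + ∑ i, w i ^ 2) ≤
      ∑ i, ∑ j, ∑ k, t i j k ^ 2 / (l i * l j) + 8 / g * ∑ j, w j / l j * ∑ i, t i i j := by
  have hpt : ∀ i j k, (t i j k + 2 / g * ((if i = k then l i * w j else 0) +
      (if j = k then l j * w i else 0))) ^ 2 / (l i * l j) =
      t i j k ^ 2 / (l i * l j) + ((if i = k then 4 / g * (w j / l j * t i j i) else 0)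
      + (if j = k then 4 / g * (w i / l i * t i j j) else 0)
      + (if i = k then 4 / g ^ 2 * (l i * (w j ^ 2 / l j)) else 0)
      + (if j = k then 4 / g ^ 2 * (l j * (w i ^ 2 / l i)) else 0)
      + (if i = k then if j = i then 8 / g ^ 2 * w i ^ 2 else 0 else 0)) := by
    intro i j k
    have hi := (hl i).ne'
    have hj := (hl j).ne'
    have hg' := hg.ne'
    by_cases h1 : i = k
    · subst h1
      by_cases h2 : j = i
      · subst h2; simp; field_simp; ring
      · simp [h2]; field_simp; ring
    · by_cases h2 : j = k
      · subst h2; simp [h1]; field_simp; ring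
      · simp [h1, h2]
  have h0 : 0 ≤ ∑ i, ∑ j, ∑ k, (t i j k + 2 / g * ((if i = k then l i * w j else 0) +
      (if j = k then l j * w i else 0))) ^ 2 / (l i * l j) :=
    Finset.sum_nonneg fun i _ => Finset.sum_nonneg fun j _ => Finset.sum_nonneg fun k _ =>
      div_nonneg (sq_nonneg _) (mul_pos (hl i) (hl j)).le
  simp only [hpt, Finset.sum_add_distrib, Finset.sum_ite_eq, Finset.mem_univ, if_true,
    Finset.sum_ite_eq', ← Finset.mul_sum] at h0
  have e1 : ∑ i, ∑ j, w j / l j * t i j i = ∑ j, w j / l j * ∑ i, t i i j := by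
    rw [Finset.sum_comm]
    simp only [Finset.mul_sum]
    exact Finset.sum_congr rfl fun i _ => Finset.sum_congr rfl fun j _ => by rw [h23]
  have e2 : ∑ i, w i / l i * ∑ j, t i j j = ∑ j, w j / l j * ∑ i, t i i j := by
    refine Finset.sum_congr rfl fun i _ => ?_
    congr 1
    exact Finset.sum_congr rfl fun j _ => by rw [h12, h23]
  have e3 : ∑ i, l i * ∑ j, w j ^ 2 / l j = (∑ i, l i) * ∑ j, w j ^ 2 / l j := by
    rw [Finset.sum_mul]
  have e4 : ∑ i, ∑ j, l j * (w i ^ 2 / l i) = (∑ i, l i) * ∑ j, w j ^ 2 / l j := by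
    rw [Finset.sum_comm, Finset.sum_mul]
    simp only [Finset.mul_sum]
  rw [e1, e2, e3, e4] at h0
  rw [← sub_nonneg]
  refine h0.trans_eq ?_
  ring

/-- The bracket on the right is the weighted square norm of V_ij = X_ij + (2/g)(δ_ij l_i² - w_i
w_j). Dropping its off-diagonal part and applying Cauchy-Schwarz to the diagonal bounds it below by
the square of ∑ V_ii / l_i, which is determined by T. -/
theorem sum_weighted_sq_quadratic_ge {ι : Type*} [Fintype ι] [DecidableEq ι] {l w : ι → ℝ}
    {g T : ℝ} {X : ι → ι → ℝ} (hl : ∀ i, 0 < l i) (hg : 0 < g)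
    (hT : ∑ i, X i i / l i = T) :
    (T + 2 / g * (∑ i, l i - ∑ i, w i ^ 2 / l i)) ^ 2 ≤ (Fintype.card ι) *
      (∑ i, ∑ j, X i j ^ 2 / (l i * l j) + 4 / g * ∑ i, X i i
        - 4 / g * ∑ i, ∑ j, w i / l i * X i j * (w j / l j)
        + 4 / g ^ 2 * (∑ i, l i ^ 2 - 2 * ∑ i, w i ^ 2 + (∑ i, w i ^ 2 / l i) ^ 2)) := by
  set V : ι → ι → ℝ := fun i j => X i j + 2 / g * ((if i = j then l i ^ 2 else 0) - w i * w j)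
  have hg' := hg.ne'
  have h1 : ∑ i, V i i / l i = T + 2 / g * (∑ i, l i - ∑ i, w i ^ 2 / l i) := by
    rw [← hT, ← Finset.sum_sub_distrib, Finset.mul_sum, ← Finset.sum_add_distrib]
    refine Finset.sum_congr rfl fun i _ => ?_
    have hi := (hl i).ne'
    simp only [V, if_true]
    field_simp
  have h2 : (∑ i, V i i / l i) ^ 2 ≤ Fintype.card ι * ∑ i, (V i i / l i) ^ 2 := by
    simpa using sq_sum_le_card_mul_sum_sq (s := Finset.univ) (f := fun i => V i i / l i)
  have h3 : ∑ i, (V i i / l i) ^ 2 ≤ ∑ i, ∑ j, V i j ^ 2 / (l i * l j) := by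
    refine Finset.sum_le_sum fun i _ => ?_
    have := Finset.single_le_sum (f := fun j => V i j ^ 2 / (l i * l j)) (s := Finset.univ)
      (fun j _ => div_nonneg (sq_nonneg _) (mul_pos (hl i) (hl j)).le) (Finset.mem_univ i)
    refine le_trans (le_of_eq ?_) this
    rw [div_pow, sq (l i)]
  have hpt : ∀ i j, V i j ^ 2 / (l i * l j) = X i j ^ 2 / (l i * l j)
      + (if i = j then 4 / g * X i i else 0) - 4 / g * (w i / l i * X i j * (w j / l j))
      + ((if i = j then 4 / g ^ 2 * l i ^ 2 - 8 / g ^ 2 * w i ^ 2 else 0)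
        + 4 / g ^ 2 * (w i ^ 2 / l i * (w j ^ 2 / l j))) := by
    intro i j
    have hi := (hl i).ne'
    have hj := (hl j).ne'
    by_cases h : i = j
    · subst h; simp [V]; field_simp; ring
    · simp [V, h]; field_simp; ring
  have h4 : ∑ i, ∑ j, V i j ^ 2 / (l i * l j) = ∑ i, ∑ j, X i j ^ 2 / (l i * l j)
      + 4 / g * ∑ i, X i i - 4 / g * ∑ i, ∑ j, w i / l i * X i j * (w j / l j)
        + 4 / g ^ 2 * (∑ i, l i ^ 2 - 2 * ∑ i, w i ^ 2 + (∑ i, w i ^ 2 / l i) ^ 2) := by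
    simp only [hpt, Finset.sum_add_distrib, Finset.sum_sub_distrib, Finset.sum_ite_eq,
      Finset.mem_univ, if_true, ← Finset.mul_sum, ← Finset.sum_mul]
    ring
  rw [← h1, ← h4]
  exact h2.trans (mul_le_mul_of_nonneg_left h3 (Nat.cast_nonneg _))

/-- For b = 0 the left side is at most -2NFH, because W ≤ H² and F ≥ 0. For b = -(N+2) the
coefficient of W is negative, so the opposite bound H² ≤ NW is the relevant one. -/
theorem curvature_scalar_neg {N H F W b : ℝ} (hN : 1 ≤ N) (hH : 0 < H) (hF : 0 ≤ F)
    (hW1 : H ^ 2 ≤ N * W) (hW2 : W ≤ H ^ 2) (hb : b = 0 ∨ b = -(N + 2)) :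
    N * ((b + 2) * W - b * (F + H) ^ 2 - 2 * (F + H) * H) < (b * (F + H) + 2 * H) ^ 2 := by
  rcases hb with rfl | rfl
  · have : 0 ≤ F * H := mul_nonneg hF hH.le
    nlinarith [mul_pos hH hH, mul_nonneg (by linarith : (0 : ℝ) ≤ N) (by linarith : 0 ≤ H ^ 2 - W),
      mul_nonneg (by linarith : (0 : ℝ) ≤ N) this]
  · have h1 : N * (N * W) ≥ N * H ^ 2 := mul_le_mul_of_nonneg_left hW1 (by linarith)
    set a := F + H
    -- After H² ≤ NW is inserted, the difference of the two sides is this quadratic form in (a, H),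
    -- up to the factor 2(N+2). It is positive definite, with discriminant -4N(N+4), whatever the
    -- sign of F.
    have h2 : 0 < 2 * (N + 2) * (2 * (N + 2) * a ^ 2 - 2 * (N + 4) * (a * H) + (N + 4) * H ^ 2) := by
      have : 2 * (N + 2) * (2 * (N + 2) * a ^ 2 - 2 * (N + 4) * (a * H) + (N + 4) * H ^ 2)
          = (2 * (N + 2) * a - (N + 4) * H) ^ 2 + N * (N + 4) * H ^ 2 := by ring
      rw [this]
      have : 0 < N * (N + 4) * H ^ 2 := by positivity
      positivity
    have h3 := pos_of_mul_pos_right h2 (by linarith)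
    nlinarith [h1, h3]

/-- The third order terms in the Laplacian of `log (|∇u| ^ (N + b) K)` at a critical point, in a
frame of principal directions. Here `l` are the tangential eigenvalues of `-D²u`, `w` the mixed
second derivatives, `t` and `X` the third derivatives, `g = |∇u|` and `F = Δu`. -/
theorem third_order_terms_lt {ι : Type*} [Fintype ι] [DecidableEq ι] [Nonempty ι] {l w : ι → ℝ}
    {g F b a s H : ℝ} {t : ι → ι → ι → ℝ} {X : ι → ι → ℝ}
    (hl : ∀ i, 0 < l i) (hg : 0 < g) (hF : 0 ≤ F)
    (hH : H = ∑ i, l i) (hs : s = ∑ i, w i ^ 2 / l i) (ha : a = F + H)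
    (hb : b = 0 ∨ b = -(Fintype.card ι + 2))
    (h12 : ∀ i j k, t i j k = t j i k) (h23 : ∀ i j k, t i j k = t i k j)
    (hX : ∑ i, X i i / l i = (2 * s + b * a) / g) :
    (b - 2) * (∑ i, l i ^ 2 - a ^ 2) / g ^ 2 <
      ∑ i, ∑ j, ∑ k, t i j k ^ 2 / (l i * l j) + 8 / g * ∑ j, w j / l j * ∑ i, t i i j
      + ∑ i, ∑ j, X i j ^ 2 / (l i * l j) + 4 / g * ∑ i, X i i
      - 4 / g * ∑ i, ∑ j, w i / l i * X i j * (w j / l j)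
      + 2 * (a + s) / g ^ 2 * (H + s + (a + s)) - 6 * F * s / g ^ 2 := by
  have h3 := sum_weighted_sq_cubic_ge hl hg h12 h23 (w := w)
  have h2 := sum_weighted_sq_quadratic_ge hl hg hX (w := w)
  rw [← hs, ← hH] at h2 h3
  set W := ∑ i, l i ^ 2
  set w2 := ∑ i, w i ^ 2
  set P3 := ∑ i, ∑ j, ∑ k, t i j k ^ 2 / (l i * l j) + 8 / g * ∑ j, w j / l j * ∑ i, t i i j
  set P2 := ∑ i, ∑ j, X i j ^ 2 / (l i * l j) + 4 / g * ∑ i, X i i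
      - 4 / g * ∑ i, ∑ j, w i / l i * X i j * (w j / l j)
  have hHpos : 0 < H := hH ▸ Finset.sum_pos (fun i _ => hl i) Finset.univ_nonempty
  have hW1 : H ^ 2 ≤ Fintype.card ι * W := by
    simpa [hH] using sq_sum_le_card_mul_sum_sq (s := Finset.univ) (f := l)
  have hW2 : W ≤ H ^ 2 := hH ▸ Finset.sum_sq_le_sq_sum_of_nonneg fun i _ => (hl i).le
  have hN : (1 : ℝ) ≤ Fintype.card ι := by exact_mod_cast Fintype.card_pos
  have key := curvature_scalar_neg hN hHpos hF hW1 hW2 hb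
  have hN0 : (0 : ℝ) < Fintype.card ι := by linarith
  -- The mixed derivatives w drop out of the trace here, which leaves a scalar inequality in F, H
  -- and ∑ l_i².
  have e : (2 * s + b * a) / g + 2 / g * (H - s) = (b * (F + H) + 2 * H) / g := by
    rw [ha]; field_simp; ring
  rw [e, div_pow, div_le_iff₀ (by positivity)] at h2
  have h2' := lt_of_mul_lt_mul_left (key.trans_le (h2.trans_eq (mul_assoc _ _ _))) hN0.le
  have h3' : -8 * (H * s + w2) ≤ P3 * g ^ 2 := by
    have := mul_le_mul_of_nonneg_right h3 (sq_nonneg g)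
    refine le_trans (le_of_eq ?_) this
    field_simp
  have h2'' : (b + 2) * W - b * (F + H) ^ 2 - 2 * (F + H) * H <
      P2 * g ^ 2 + 4 * (W - 2 * w2 + s ^ 2) := by
    refine h2'.trans_eq ?_
    field_simp
  have : P3 + ∑ i, ∑ j, X i j ^ 2 / (l i * l j) + 4 / g * ∑ i, X i i
      - 4 / g * ∑ i, ∑ j, w i / l i * X i j * (w j / l j)
      + 2 * (a + s) / g ^ 2 * (H + s + (a + s)) - 6 * F * s / g ^ 2 =
      ((P3 + P2) * g ^ 2 + 2 * (a + s) * (H + s + (a + s)) - 6 * F * s) / g ^ 2 := by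
    simp only [P2]; field_simp; ring
  rw [this, div_lt_div_iff_of_pos_right (by positivity)]
  -- With a = F + H all terms in s and ∑ w_i² cancel when the two bounds are added. The summand -6Fs
  -- is exactly what this cancellation leaves over for the source term.
  subst ha
  nlinarith [h3', h2'']

/-! ### Derivatives of determinants and inverses; the second derivative test -/

/-- Jacobi's formula. By the Leibniz expansion, the derivative is the sum over k of the determinants
with column k differentiated, and Cramer's rule identifies these with the diagonal of adj(M) M'. -/
theorem hasDerivAt_det {m : Type*} [Fintype m] [DecidableEq m] {M : ℝ → Matrix m m ℝ}
    {M' : Matrix m m ℝ} {t : ℝ} (h : ∀ i j, HasDerivAt (fun s => M s i j) (M' i j) t) :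
    HasDerivAt (fun s => (M s).det) ((M t).adjugate * M').trace t := by
  have h1 : HasDerivAt (fun s => (M s).det) (∑ σ : Equiv.Perm m, ((Equiv.Perm.sign σ : ℤ) : ℝ) *
      ∑ k, (∏ i ∈ Finset.univ.erase k, M t (σ i) i) • M' (σ k) k) t := by
    simp only [Matrix.det_apply']
    exact HasDerivAt.fun_sum fun σ _ =>
      (HasDerivAt.fun_finsetProd fun i _ => h (σ i) i).const_mul _
  have h2 : ∀ k, ((M t).adjugate * M') k k = ∑ σ : Equiv.Perm m,
      ((Equiv.Perm.sign σ : ℤ) : ℝ) * ((∏ i ∈ Finset.univ.erase k, M t (σ i) i) • M' (σ k) k) := by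
    intro k
    have : ((M t).adjugate * M') k k = ((M t).updateCol k (fun i => M' i k)).det := by
      rw [← Matrix.cramer_apply, Matrix.cramer_eq_adjugate_mulVec]
      rfl
    rw [this, Matrix.det_apply']
    refine Finset.sum_congr rfl fun σ _ => ?_
    rw [← Finset.prod_erase_mul _ _ (Finset.mem_univ k), Matrix.updateCol_self, smul_eq_mul]
    congr 2
    refine Finset.prod_congr rfl fun i hi => ?_
    rw [Matrix.updateCol_ne (Finset.ne_of_mem_erase hi)]
  convert h1 using 1
  rw [Matrix.trace, Finset.sum_congr rfl fun k _ => (Matrix.diag_apply _ _).trans (h2 k),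
    Finset.sum_comm]
  simp only [Finset.mul_sum]

theorem hasDerivAt_log_det {m : Type*} [Fintype m] [DecidableEq m] {M : ℝ → Matrix m m ℝ}
    {M' : Matrix m m ℝ} {t : ℝ} (h : ∀ i j, HasDerivAt (fun s => M s i j) (M' i j) t)
    (h0 : (M t).det ≠ 0) :
    HasDerivAt (fun s => Real.log (M s).det) ((M t)⁻¹ * M').trace t := by
  convert (hasDerivAt_det h).log h0 using 1
  rw [Matrix.inv_def, Ring.inverse_eq_inv', Matrix.smul_mul, Matrix.trace_smul, smul_eq_mul,
    div_eq_inv_mul]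

/-- Cramer's rule shows that the entries are differentiable; the value then follows by
differentiating M⁻¹M = 1. -/
theorem hasDerivAt_inv_apply {m : Type*} [Fintype m] [DecidableEq m] {M : ℝ → Matrix m m ℝ}
    {M' : Matrix m m ℝ} {t : ℝ} (h : ∀ i j, HasDerivAt (fun s => M s i j) (M' i j) t)
    (h0 : (M t).det ≠ 0) (i j : m) :
    HasDerivAt (fun s => (M s)⁻¹ i j) (-((M t)⁻¹ * M' * (M t)⁻¹) i j) t := by
  have hex : ∀ i j, ∃ r, HasDerivAt (fun s => (M s)⁻¹ i j) r t := by
    intro i j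
    have h1 : ∀ a b, HasDerivAt (fun s => (M s).updateRow j (Pi.single i 1) a b)
        ((M'.updateRow j 0) a b) t := by
      intro a b
      by_cases ha : a = j
      · subst ha
        simpa using hasDerivAt_const t _
      · simpa [Matrix.updateRow_ne ha] using h a b
    have h2 := hasDerivAt_det h1
    refine ⟨_, (((hasDerivAt_det h).fun_inv h0).mul h2).congr_of_eventuallyEq
      (Eventually.of_forall fun s => ?_)⟩
    simp [Matrix.inv_def, Ring.inverse_eq_inv', Matrix.adjugate_apply]
  choose R hR using hex
  have hev : ∀ᶠ s in 𝓝 t, (M s).det ≠ 0 :=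
    (hasDerivAt_det h).continuousAt.eventually_ne h0
  have h1 : Matrix.of R * M t + (M t)⁻¹ * M' = 0 := by
    ext a b
    have h2 : HasDerivAt (fun s => ((M s)⁻¹ * M s) a b)
        ((Matrix.of R * M t + (M t)⁻¹ * M') a b) t := by
      simp only [Matrix.mul_apply, Matrix.add_apply, ← Finset.sum_add_distrib]
      exact HasDerivAt.fun_sum fun k _ => (hR a k).mul (h k b)
    have h3 : (fun s => ((M s)⁻¹ * M s) a b) =ᶠ[𝓝 t] fun _ => (1 : Matrix m m ℝ) a b := by
      filter_upwards [hev] with s hs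
      rw [Matrix.nonsing_inv_mul _ (isUnit_iff_ne_zero.mpr hs)]
    exact h2.unique ((hasDerivAt_const t _).congr_of_eventuallyEq h3)
  have h4 : Matrix.of R = -((M t)⁻¹ * M' * (M t)⁻¹) := by
    have := congrArg (· * (M t)⁻¹) h1
    simp only [Matrix.add_mul, Matrix.mul_assoc, Matrix.zero_mul,
      Matrix.mul_nonsing_inv _ (isUnit_iff_ne_zero.mpr h0), Matrix.mul_one] at this
    rw [Matrix.mul_assoc]
    exact eq_neg_of_add_eq_zero_left this
  have h5 : R i j = -((M t)⁻¹ * M' * (M t)⁻¹) i j := congrFun (congrFun h4 i) j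
  exact h5 ▸ hR i j

theorem hasDerivAt_trace_inv_mul {m : Type*} [Fintype m] [DecidableEq m] {M M₁ : ℝ → Matrix m m ℝ}
    {M₂ : Matrix m m ℝ} {t : ℝ} (h : ∀ i j, HasDerivAt (fun s => M s i j) (M₁ t i j) t)
    (h' : ∀ i j, HasDerivAt (fun s => M₁ s i j) (M₂ i j) t) (h0 : (M t).det ≠ 0) :
    HasDerivAt (fun s => ((M s)⁻¹ * M₁ s).trace)
      (((M t)⁻¹ * M₂).trace - ((M t)⁻¹ * M₁ t * ((M t)⁻¹ * M₁ t)).trace) t := by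
  have : ((M t)⁻¹ * M₂).trace - ((M t)⁻¹ * M₁ t * ((M t)⁻¹ * M₁ t)).trace =
      ∑ i, ∑ k, (-((M t)⁻¹ * M₁ t * (M t)⁻¹) i k * M₁ t k i + (M t)⁻¹ i k * M₂ k i) := by
    simp only [Finset.sum_add_distrib, neg_mul, Finset.sum_neg_distrib, ← Matrix.mul_apply,
      ← Matrix.mul_assoc]
    rw [Matrix.trace, Matrix.trace]
    simp only [Matrix.diag_apply]
    ring
  rw [this]
  simp only [Matrix.trace, Matrix.diag_apply, Matrix.mul_apply]
  simp only [← Matrix.mul_apply]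
  exact HasDerivAt.fun_sum fun i _ => HasDerivAt.fun_sum fun k _ =>
    (hasDerivAt_inv_apply h h0 i k).mul (h' k i)

/-- Were f₂ negative, the point would be a local maximum as well. Then f would be locally constant
and f₂ zero. -/
theorem IsLocalMin.second_deriv_nonneg {f f₁ : ℝ → ℝ} {f₂ t : ℝ} (hmin : IsLocalMin f t)
    (h1 : ∀ᶠ s in 𝓝 t, HasDerivAt f (f₁ s) s) (h2 : HasDerivAt f₁ f₂ t) :
    f₁ t = 0 ∧ 0 ≤ f₂ := by
  have h0 : f₁ t = 0 := hmin.hasDerivAt_eq_zero h1.self_of_nhds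
  refine ⟨h0, ?_⟩
  by_contra! hneg
  have hd : deriv f =ᶠ[𝓝 t] f₁ := h1.mono fun s hs => hs.deriv
  have hmax : IsLocalMax f t := isLocalMax_of_deriv_deriv_neg
    (by rw [hd.deriv_eq, h2.deriv]; exact hneg) (by rw [hd.self_of_nhds, h0])
    h1.self_of_nhds.continuousAt
  have hconst : f =ᶠ[𝓝 t] fun _ => f t := by
    filter_upwards [hmin, hmax] with s hs hs' using le_antisymm hs' hs
  have h3 : f₁ =ᶠ[𝓝 t] fun _ => 0 := by
    filter_upwards [h1, hconst.eventuallyEq_nhds] with s hs hs'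
    exact hs.unique ((hasDerivAt_const s _).congr_of_eventuallyEq hs')
  exact hneg.ne (h2.unique ((hasDerivAt_const t _).congr_of_eventuallyEq h3))

/-! ### Linear algebra of the normal form -/

/-- The inverse of the bordered Hessian in a frame in which it is in normal form. -/
theorem inv_fromBlocks_diagonal_antidiag {ι : Type*} [Fintype ι] [DecidableEq ι] {l : ι → ℝ} {g : ℝ}
    (hl : ∀ i, l i ≠ 0) (hg : g ≠ 0) :
    (Matrix.fromBlocks (Matrix.diagonal fun i => -l i) 0 0 !![0, g; g, 0])⁻¹ =
      Matrix.fromBlocks (Matrix.diagonal fun i => -(l i)⁻¹) 0 0 !![0, g⁻¹; g⁻¹, 0] := by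
  refine Matrix.inv_eq_left_inv ?_
  rw [Matrix.fromBlocks_multiply, ← Matrix.fromBlocks_one]
  congr 1
  · simp [Matrix.diagonal_mul_diagonal, hl]
  · simp
  · simp
  · ext i j
    fin_cases i <;> fin_cases j <;> simp [hg]

theorem trace_mul_fromBlocks {ι : Type*} [Fintype ι] [DecidableEq ι] {l : ι → ℝ} {g : ℝ}
    (M : Matrix (ι ⊕ Fin 2) (ι ⊕ Fin 2) ℝ) (hM : M.IsSymm) :
    (Matrix.fromBlocks (Matrix.diagonal fun i => -(l i)⁻¹) 0 0 !![0, g⁻¹; g⁻¹, 0] * M).trace =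
      -∑ i, M (.inl i) (.inl i) / l i + 2 * M (.inr 0) (.inr 1) / g := by
  have h := hM.apply (.inr 0) (.inr 1)
  simp [Matrix.trace, Matrix.mul_apply, Matrix.diagonal_apply, h, Fin.sum_univ_two]
  congr 1
  · simp only [neg_inj]
    exact Finset.sum_congr rfl fun i _ => by ring
  · ring

theorem trace_mul_fromBlocks_sq {ι : Type*} [Fintype ι] [DecidableEq ι] {l : ι → ℝ} {g : ℝ}
    (M : Matrix (ι ⊕ Fin 2) (ι ⊕ Fin 2) ℝ) (hM : M.IsSymm)
    (h0 : M (.inr 1) (.inr 1) = 0) :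
    (Matrix.fromBlocks (Matrix.diagonal fun i => -(l i)⁻¹) 0 0 !![0, g⁻¹; g⁻¹, 0] * M *
      (Matrix.fromBlocks (Matrix.diagonal fun i => -(l i)⁻¹) 0 0 !![0, g⁻¹; g⁻¹, 0] * M)).trace =
      ∑ i, ∑ j, M (.inl i) (.inl j) ^ 2 / (l i * l j)
        - 4 / g * ∑ i, M (.inl i) (.inr 0) * M (.inl i) (.inr 1) / l i
        + 2 * M (.inr 0) (.inr 1) ^ 2 / g ^ 2 := by
  have h := hM.apply (.inr 0) (.inr 1)
  have h1 : ∀ i, M (.inr 0) (.inl i) = M (.inl i) (.inr 0) := fun i => hM.apply _ _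
  have h2 : ∀ i, M (.inr 1) (.inl i) = M (.inl i) (.inr 1) := fun i => hM.apply _ _
  have h3 : ∀ i j, M (.inl j) (.inl i) = M (.inl i) (.inl j) := fun i j => hM.apply _ _
  set C := Matrix.fromBlocks (Matrix.diagonal fun i => -(l i)⁻¹) 0 0 !![0, g⁻¹; g⁻¹, 0]
  have c1 : ∀ i q, (C * M) (.inl i) q = -(l i)⁻¹ * M (.inl i) q := by
    intro i q
    simp [C, Matrix.mul_apply, Matrix.diagonal_apply]
  have c2 : ∀ q, (C * M) (.inr 0) q = g⁻¹ * M (.inr 1) q := by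
    intro q
    simp [C, Matrix.mul_apply]
  have c3 : ∀ q, (C * M) (.inr 1) q = g⁻¹ * M (.inr 0) q := by
    intro q
    simp [C, Matrix.mul_apply]
  simp only [Matrix.trace, Matrix.diag_apply, Matrix.mul_apply (M := C * M), Fintype.sum_sum_type,
    Fin.sum_univ_two, c1, c2, c3, h, h0, h1, h2]
  simp only [Finset.sum_add_distrib, Finset.mul_sum]
  have e1 : ∑ i, ∑ j, -(l i)⁻¹ * M (.inl i) (.inl j) * (-(l j)⁻¹ * M (.inl j) (.inl i)) =
      ∑ i, ∑ j, M (.inl i) (.inl j) ^ 2 / (l i * l j) :=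
    Finset.sum_congr rfl fun i _ => Finset.sum_congr rfl fun j _ => by
      rw [h3 i j]; field_simp
  rw [e1]
  have e2 : ∀ i, 4 / g * (M (.inl i) (.inr 0) * M (.inl i) (.inr 1) / l i) =
     4 * ((l i)⁻¹ * g⁻¹ * M (.inl i) (.inr 0) * M (.inl i) (.inr 1)) := fun i => by ring
  simp only [e2, ← Finset.mul_sum]
  have e3 : ∑ i, -(l i)⁻¹ * M (.inl i) (.inr 0) * (g⁻¹ * M (.inl i) (.inr 1)) =
     -∑ i, ((l i)⁻¹ * g⁻¹ * M (.inl i) (.inr 0) * M (.inl i) (.inr 1)) := by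
    rw [← Finset.sum_neg_distrib]; exact Finset.sum_congr rfl fun i _ => by ring
  have e4 : ∑ i, -(l i)⁻¹ * M (.inl i) (.inr 1) * (g⁻¹ * M (.inl i) (.inr 0)) =
     -∑ i, ((l i)⁻¹ * g⁻¹ * M (.inl i) (.inr 0) * M (.inl i) (.inr 1)) := by
    rw [← Finset.sum_neg_distrib]; exact Finset.sum_congr rfl fun i _ => by ring
  have e5 : ∑ i, g⁻¹ * M (.inl i) (.inr 1) * (-(l i)⁻¹ * M (.inl i) (.inr 0)) =
     -∑ i, ((l i)⁻¹ * g⁻¹ * M (.inl i) (.inr 0) * M (.inl i) (.inr 1)) := by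
    rw [← Finset.sum_neg_distrib]; exact Finset.sum_congr rfl fun i _ => by ring
  have e6 : ∑ i, g⁻¹ * M (.inl i) (.inr 0) * (-(l i)⁻¹ * M (.inl i) (.inr 1)) =
     -∑ i, ((l i)⁻¹ * g⁻¹ * M (.inl i) (.inr 0) * M (.inl i) (.inr 1)) := by
    rw [← Finset.sum_neg_distrib]; exact Finset.sum_congr rfl fun i _ => by ring
  rw [e3, e4, e5, e6]
  ring

/-! ### The bordered determinant and the Gaussian curvature -/

/-- The bordered bilinear form `(x, r), (y, s) ↦ ⟨A x, y⟩ + r ⟨p, y⟩ + s ⟨p, x⟩`. -/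
noncomputable def borderedForm {n : ℕ} (p : Eucl n) (A : Eucl n →L[ℝ] Eucl n) :
    LinearMap.BilinForm ℝ (Eucl n × ℝ) :=
  LinearMap.mk₂ ℝ (fun x y => ⟪A x.1, y.1⟫_ℝ + x.2 * ⟪p, y.1⟫_ℝ + y.2 * ⟪p, x.1⟫_ℝ)
    (fun x x' y => by simp [inner_add_left, inner_add_right]; ring)
    (fun c x y => by simp [inner_smul_left, inner_smul_right]; ring)
    (fun x y y' => by simp [inner_add_right]; ring)
    (fun c x y => by simp [inner_smul_right]; ring)

/-- The Euclidean bilinear form on `ℝⁿ × ℝ`. -/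
noncomputable def prodInnerForm (n : ℕ) : LinearMap.BilinForm ℝ (Eucl n × ℝ) :=
  LinearMap.mk₂ ℝ (fun x y => ⟪x.1, y.1⟫_ℝ + x.2 * y.2)
    (fun x x' y => by simp [inner_add_left]; ring)
    (fun c x y => by simp [inner_smul_left]; ring)
    (fun x y y' => by simp [inner_add_right]; ring)
    (fun c x y => by simp [inner_smul_right]; ring)

/-- The matrix of a bilinear form in a finite family. -/
def formMatrix {V κ : Type*} [AddCommGroup V] [Module ℝ V] (B : LinearMap.BilinForm ℝ V)
    (b : κ → V) : Matrix κ κ ℝ := Matrix.of fun i j => B (b i) (b j)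

theorem formMatrix_eq_mul {V κ : Type*} [AddCommGroup V] [Module ℝ V] [Fintype κ]
    (B : LinearMap.BilinForm ℝ V) {b c : κ → V} {P : Matrix κ κ ℝ}
    (h : ∀ i, c i = ∑ j, P i j • b j) :
    formMatrix B c = P * formMatrix B b * P.transpose := by
  ext i j
  simp only [formMatrix, Matrix.of_apply, Matrix.mul_apply, Matrix.transpose_apply, h i, h j,
    map_sum, map_smul, LinearMap.sum_apply, LinearMap.smul_apply, smul_eq_mul, Finset.sum_mul,
    Finset.mul_sum]
  exact Finset.sum_congr rfl fun x _ => Finset.sum_congr rfl fun y _ => by ring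

theorem det_formMatrix_eq {V κ : Type*} [AddCommGroup V] [Module ℝ V] [Fintype κ] [DecidableEq κ]
    (B : LinearMap.BilinForm ℝ V) {b c : κ → V} {P : Matrix κ κ ℝ}
    (h : ∀ i, c i = ∑ j, P i j • b j) :
    (formMatrix B c).det = P.det ^ 2 * (formMatrix B b).det := by
  rw [formMatrix_eq_mul B h, Matrix.det_mul, Matrix.det_mul, Matrix.det_transpose]
  ring

/-- The family `(e₁, 0), …, (e_N, 0), (e_{N+1}, 0), (0, 1)` of `ℝⁿ × ℝ`. -/
def extendedFrame {n N : ℕ} (e : Fin N ⊕ Unit → Eucl n) : Fin N ⊕ Fin 2 → Eucl n × ℝ :=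
  Sum.elim (fun i => (e (.inl i), 0)) ![(e (.inr ()), 0), (0, 1)]

theorem exists_coord_extendedFrame {n N : ℕ} (e : OrthonormalBasis (Fin N ⊕ Unit) ℝ (Eucl n))
    {κ : Type*} (c : κ → Eucl n × ℝ) :
    ∃ P : Matrix κ (Fin N ⊕ Fin 2) ℝ, ∀ i, c i = ∑ j, P i j • extendedFrame e j := by
  refine ⟨Matrix.of fun i => Sum.elim (fun j => ⟪e (.inl j), (c i).1⟫_ℝ)
    ![⟪e (.inr ()), (c i).1⟫_ℝ, (c i).2], fun i => ?_⟩
  have h := e.sum_repr' (c i).1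
  rw [Fintype.sum_sum_type] at h
  ext1
  · rw [← h]
    simp [extendedFrame, Prod.fst_sum, Fin.sum_univ_two]
  · simp [extendedFrame, Prod.snd_sum, Fin.sum_univ_two]

theorem formMatrix_prodInnerForm {n N : ℕ} (e : OrthonormalBasis (Fin N ⊕ Unit) ℝ (Eucl n)) :
    formMatrix (prodInnerForm n) (extendedFrame e) = 1 := by
  have h := orthonormal_iff_ite.mp e.orthonormal
  ext i j
  rcases i with i | i <;> rcases j with j | j
  · simp [formMatrix, prodInnerForm, extendedFrame, h, Matrix.one_apply]
  · fin_cases j <;> simp [formMatrix, prodInnerForm, extendedFrame, h]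
  · fin_cases i <;> simp [formMatrix, prodInnerForm, extendedFrame, h]
  · fin_cases i <;> fin_cases j <;>
      simp [formMatrix, prodInnerForm, extendedFrame]

/-- The Gram matrix of the Euclidean form is the identity in both families, so the transition matrix
P satisfies det P ^ 2 = 1. -/
theorem det_formMatrix_extendedFrame_eq {n N : ℕ}
    (e e' : OrthonormalBasis (Fin N ⊕ Unit) ℝ (Eucl n))
    (B : LinearMap.BilinForm ℝ (Eucl n × ℝ)) :
    (formMatrix B (extendedFrame e)).det = (formMatrix B (extendedFrame e')).det := by
  obtain ⟨P, hP⟩ := exists_coord_extendedFrame e' (extendedFrame e)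
  have h := det_formMatrix_eq (prodInnerForm n) hP
  rw [formMatrix_prodInnerForm, formMatrix_prodInnerForm, Matrix.det_one, mul_one] at h
  rw [det_formMatrix_eq B hP, ← h, one_mul]

/-- An orthonormal basis of `p^⊥` completed by `p / |p|`. -/
theorem exists_orthonormalBasis_extending {n N : ℕ} (hn : n = N + 1) {p : Eucl n} (hp : p ≠ 0)
    (c : OrthonormalBasis (Fin N) ℝ (ℝ ∙ p)ᗮ) :
    ∃ e : OrthonormalBasis (Fin N ⊕ Unit) ℝ (Eucl n),
      (∀ i, e (.inl i) = c i) ∧ e (.inr ()) = ‖p‖⁻¹ • p := by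
  set v : Fin N ⊕ Unit → Eucl n := Sum.elim (fun i => (c i : Eucl n)) fun _ => ‖p‖⁻¹ • p
  have hc := orthonormal_iff_ite.mp c.orthonormal
  have hcp : ∀ i, ⟪p, (c i : Eucl n)⟫_ℝ = 0 := fun i =>
    Submodule.mem_orthogonal_singleton_iff_inner_right.mp (c i).2
  have hcp' : ∀ i, ⟪(c i : Eucl n), p⟫_ℝ = 0 := fun i => by rw [real_inner_comm, hcp]
  have hp' : ‖p‖ ≠ 0 := norm_ne_zero_iff.mpr hp
  have hv : Orthonormal ℝ v := by
    rw [orthonormal_iff_ite]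
    rintro (i | i) (j | j)
    · simpa [v] using hc i j
    · simp [v, inner_smul_right, hcp']
    · simp [v, inner_smul_left, hcp]
    · simp [v, norm_smul, hp']
  obtain ⟨e, he⟩ := Orthonormal.exists_orthonormalBasis_extension_of_card_eq
    (𝕜 := ℝ) (E := Eucl n) (ι := Fin N ⊕ Unit) (v := v) (s := univ) (by simp [hn])
    (hv.comp _ Subtype.val_injective)
  exact ⟨e, fun i => he _ (mem_univ _), he _ (mem_univ _)⟩

theorem inner_shapeOperator {n : ℕ} (p : Eucl n) (A : Eucl n →L[ℝ] Eucl n) (v w : (ℝ ∙ p)ᗮ) :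
    ⟪w, shapeOperator p A v⟫_ℝ = -(‖p‖⁻¹ * ⟪A v, (w : Eucl n)⟫_ℝ) := by
  simp only [shapeOperator, LinearMap.neg_apply, LinearMap.smul_apply, inner_neg_right,
    inner_smul_right]
  congr 2
  rw [real_inner_comm (w : Eucl n)]
  exact Submodule.inner_orthogonalProjectionOnto_eq_of_mem_left w (A v)

/-- The Gaussian curvature is, up to sign and a power of `|p|`, the bordered determinant. -/
theorem det_formMatrix_borderedForm {n N : ℕ} (hn : n = N + 1) {p : Eucl n} (hp : p ≠ 0)
    (A : Eucl n →L[ℝ] Eucl n) (e : OrthonormalBasis (Fin N ⊕ Unit) ℝ (Eucl n)) :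
    (formMatrix (borderedForm p A) (extendedFrame e)).det =
      (-1) ^ (N + 1) * ‖p‖ ^ (N + 2) * LinearMap.det (shapeOperator p A) := by
  have : Fact (Module.finrank ℝ (Eucl n) = N + 1) := ⟨by simp [hn]⟩
  have hp' : ‖p‖ ≠ 0 := norm_ne_zero_iff.mpr hp
  have c : OrthonormalBasis (Fin N) ℝ (ℝ ∙ p)ᗮ := (stdOrthonormalBasis ℝ _).reindex
    (finCongr (Submodule.finrank_orthogonal_span_singleton hp))
  obtain ⟨f, hf, hfn⟩ := exists_orthonormalBasis_extending hn hp c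
  have hcp : ∀ i, ⟪p, (c i : Eucl n)⟫_ℝ = 0 := fun i =>
    Submodule.mem_orthogonal_singleton_iff_inner_right.mp (c i).2
  rw [det_formMatrix_extendedFrame_eq e f]
  set ν : Eucl n := ‖p‖⁻¹ • p
  have hpν : ⟪p, ν⟫_ℝ = ‖p‖ := by
    simp only [ν, inner_smul_right, real_inner_self_eq_norm_sq]; field_simp
  set S := LinearMap.toMatrix c.toBasis c.toBasis (shapeOperator p A)
  have hblocks : formMatrix (borderedForm p A) (extendedFrame f) =
      Matrix.fromBlocks (-‖p‖ • S.transpose)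
        (Matrix.of fun i => ![⟪A (c i), ν⟫_ℝ, 0]) (Matrix.of ![fun j => ⟪A ν, c j⟫_ℝ, 0])
        !![⟪A ν, ν⟫_ℝ, ‖p‖; ‖p‖, 0] := by
    ext i j
    rcases i with i | i <;> rcases j with j | j
    · have : S j i = -(‖p‖⁻¹ * ⟪A (c i), (c j : Eucl n)⟫_ℝ) := by
        rw [← inner_shapeOperator]
        simp [S, LinearMap.toMatrix_apply, c.repr_apply_apply]
      simp only [formMatrix, borderedForm, extendedFrame, Matrix.of_apply, LinearMap.mk₂_apply,
        Sum.elim_inl, hf, Matrix.fromBlocks_apply₁₁, Matrix.smul_apply, Matrix.transpose_apply,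
        this, smul_eq_mul]
      field_simp
      simp
    · fin_cases j <;> simp [formMatrix, borderedForm, extendedFrame, hf, hfn, hcp]
    · fin_cases i <;> simp [formMatrix, borderedForm, extendedFrame, hf, hfn, hcp]
    · fin_cases i <;> fin_cases j <;> simp [formMatrix, borderedForm, extendedFrame, hfn, hpν]
  set D : Matrix (Fin 2) (Fin 2) ℝ := !![⟪A ν, ν⟫_ℝ, ‖p‖; ‖p‖, 0]
  have hD : D * !![0, ‖p‖⁻¹; ‖p‖⁻¹, -⟪A ν, ν⟫_ℝ / ‖p‖ ^ 2] = 1 := by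
    ext i j
    fin_cases i <;> fin_cases j <;> simp [D, hp']
    field_simp; ring
  let : Invertible D := invertibleOfRightInverse _ _ hD
  -- The Schur complement has no correction term: the off-diagonal blocks involve only the first
  -- index of the 2 × 2 block, and D⁻¹ has a zero in that diagonal position.
  have hBC : (Matrix.of fun i => ![⟪A (c i), ν⟫_ℝ, 0]) * ⅟D *
      (Matrix.of ![fun j => ⟪A ν, c j⟫_ℝ, 0]) = 0 := by
    have : ⅟D = !![0, ‖p‖⁻¹; ‖p‖⁻¹, -⟪A ν, ν⟫_ℝ / ‖p‖ ^ 2] := rfl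
    rw [this]
    ext i j
    simp [Matrix.mul_apply, Fin.sum_univ_two]
  rw [hblocks, Matrix.det_fromBlocks₂₂, hBC, sub_zero, Matrix.det_smul, Matrix.det_transpose,
    LinearMap.det_toMatrix]
  simp only [D, Matrix.det_fin_two_of, Fintype.card_fin]
  rw [neg_pow]
  ring

/-! ### Directional derivatives, the Hessian and the Laplacian -/

/-- The directional derivative `∂_v φ`. -/
noncomputable def dirDeriv {n : ℕ} (v : Eucl n) (φ : Eucl n → ℝ) : Eucl n → ℝ :=
  fun x => fderiv ℝ φ x v

section dirDeriv

variable {n : ℕ} {Ω : Set (Eucl n)} {φ ψ : Eucl n → ℝ} {x : Eucl n}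

theorem ContDiffOn.dirDeriv {k m : ℕ∞ω} (h : ContDiffOn ℝ k φ Ω) (ho : IsOpen Ω)
    (hm : m + 1 ≤ k) (v : Eucl n) : ContDiffOn ℝ m (dirDeriv v φ) Ω :=
  (h.fderiv_of_isOpen ho hm).clm_apply contDiffOn_const

theorem dirDeriv_comm (h : ContDiffOn ℝ 2 φ Ω) (ho : IsOpen Ω) (hx : x ∈ Ω) (v w : Eucl n) :
    dirDeriv v (dirDeriv w φ) x = dirDeriv w (dirDeriv v φ) x := by
  have hd : DifferentiableAt ℝ (fderiv ℝ φ) x :=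
    ((h.fderiv_of_isOpen ho (m := 1) (by norm_num)).differentiableOn (by norm_num)).differentiableAt
      (ho.mem_nhds hx)
  have hs : IsSymmSndFDerivAt ℝ φ x :=
    (h.contDiffAt (ho.mem_nhds hx)).isSymmSndFDerivAt (by simp)
  have key : ∀ v w, _root_.dirDeriv v (_root_.dirDeriv w φ) x = fderiv ℝ (fderiv ℝ φ) x v w := by
    intro v w
    unfold _root_.dirDeriv
    rw [fderiv_clm_apply hd (differentiableAt_const _)]
    simp
  rw [key, key, hs.eq]

theorem dirDeriv_congr (ho : IsOpen Ω) (h : EqOn φ ψ Ω) (v : Eucl n) :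
    EqOn (dirDeriv v φ) (dirDeriv v ψ) Ω := fun _ hx => by
  unfold dirDeriv
  rw [(h.eventuallyEq_of_mem (ho.mem_nhds hx)).fderiv_eq]

theorem dirDeriv_add_left (v w : Eucl n) (φ : Eucl n → ℝ) (x : Eucl n) :
    dirDeriv (v + w) φ x = dirDeriv v φ x + dirDeriv w φ x := map_add _ _ _

theorem dirDeriv_smul_left (c : ℝ) (v : Eucl n) (φ : Eucl n → ℝ) (x : Eucl n) :
    dirDeriv (c • v) φ x = c * dirDeriv v φ x := map_smul _ _ _

theorem dirDeriv_sum_left {ι : Type*} (s : Finset ι) (v : ι → Eucl n) (φ : Eucl n → ℝ)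
    (x : Eucl n) : dirDeriv (∑ i ∈ s, v i) φ x = ∑ i ∈ s, dirDeriv (v i) φ x := map_sum _ _ _

theorem dirDeriv_sum_right {ι : Type*} (s : Finset ι) {f : ι → Eucl n → ℝ}
    (hf : ∀ i ∈ s, ContDiffOn ℝ 1 (f i) Ω) (ho : IsOpen Ω) (hx : x ∈ Ω) (v : Eucl n) :
    dirDeriv v (fun y => ∑ i ∈ s, f i y) x = ∑ i ∈ s, dirDeriv v (f i) x := by
  unfold dirDeriv
  rw [fderiv_fun_sum fun i hi => ((hf i hi).differentiableOn (by norm_num)).differentiableAt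
    (ho.mem_nhds hx)]
  simp

theorem hasDerivAt_comp_line (h : ContDiffOn ℝ 1 φ Ω) (ho : IsOpen Ω) (v : Eucl n) {s : ℝ}
    (hx : x + s • v ∈ Ω) :
    HasDerivAt (fun s => φ (x + s • v)) (dirDeriv v φ (x + s • v)) s := by
  have h1 : HasFDerivAt φ (fderiv ℝ φ (x + s • v)) (x + s • v) :=
    ((h.differentiableOn (by norm_num)).differentiableAt (ho.mem_nhds hx)).hasFDerivAt
  have h2 : HasDerivAt (fun s : ℝ => x + s • v) v s := by
    simpa using ((hasDerivAt_id s).smul_const v).const_add x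
  exact h1.comp_hasDerivAt s h2

theorem eventually_line_mem (ho : IsOpen Ω) (hx : x ∈ Ω) (v : Eucl n) :
    ∀ᶠ s : ℝ in 𝓝 0, x + s • v ∈ Ω := by
  have : ContinuousAt (fun s : ℝ => x + s • v) 0 := by fun_prop
  exact this.eventually_mem (by simpa using ho.mem_nhds hx)

theorem inner_gradient_eq_dirDeriv (v : Eucl n) : ⟪∇ φ x, v⟫_ℝ = dirDeriv v φ x :=
  inner_gradient_left

theorem ContDiffOn.gradient_of_isOpen {k m : ℕ∞ω} (h : ContDiffOn ℝ k φ Ω) (ho : IsOpen Ω)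
    (hm : m + 1 ≤ k) : ContDiffOn ℝ m (∇ φ) Ω :=
  (InnerProductSpace.toDual ℝ (Eucl n)).symm.contDiff.comp_contDiffOn (h.fderiv_of_isOpen ho hm)

theorem inner_hessian_eq_dirDeriv (h : ContDiffOn ℝ 2 φ Ω) (ho : IsOpen Ω) (hx : x ∈ Ω)
    (v w : Eucl n) : ⟪hessian φ x v, w⟫_ℝ = dirDeriv v (dirDeriv w φ) x := by
  have hd : DifferentiableAt ℝ (∇ φ) x :=
    ((h.gradient_of_isOpen ho (m := 1) (by norm_num)).differentiableOn
      (by norm_num)).differentiableAt (ho.mem_nhds hx)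
  have : _root_.dirDeriv w φ = fun y => ⟪∇ φ y, w⟫_ℝ :=
    funext fun y => (inner_gradient_eq_dirDeriv w).symm
  rw [this, _root_.dirDeriv, fderiv_inner_apply ℝ hd (differentiableAt_const _)]
  simp [hessian]

theorem laplacian_eq_sum_dirDeriv {ι : Type*} [Fintype ι] (h : ContDiffOn ℝ 2 φ Ω)
    (ho : IsOpen Ω) (hx : x ∈ Ω) (e : OrthonormalBasis ι ℝ (Eucl n)) :
    (Δ φ) x = ∑ i, dirDeriv (e i) (dirDeriv (e i) φ) x := by
  have hd : DifferentiableAt ℝ (fderiv ℝ φ) x :=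
    ((h.fderiv_of_isOpen ho (m := 1) (by norm_num)).differentiableOn (by norm_num)).differentiableAt
      (ho.mem_nhds hx)
  rw [InnerProductSpace.laplacian_eq_iteratedFDeriv_orthonormalBasis φ e]
  refine Finset.sum_congr rfl fun i _ => ?_
  unfold _root_.dirDeriv
  rw [fderiv_clm_apply hd (differentiableAt_const _)]
  simp [iteratedFDeriv_two_apply]

end dirDeriv

/-! ### The bordered Hessian as a function of the point -/

/-- The bordered Hessian matrix of `φ` in a family of vectors of `ℝⁿ × ℝ`. -/
noncomputable def borderedHessian {n : ℕ} {κ : Type*} (φ : Eucl n → ℝ) (b : κ → Eucl n × ℝ)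
    (x : Eucl n) : Matrix κ κ ℝ :=
  Matrix.of fun i j => dirDeriv (b i).1 (dirDeriv (b j).1 φ) x +
    (b i).2 * dirDeriv (b j).1 φ x + (b j).2 * dirDeriv (b i).1 φ x

section borderedHessian

variable {n : ℕ} {Ω : Set (Eucl n)} {φ ψ : Eucl n → ℝ} {x : Eucl n} {κ : Type*}

theorem borderedHessian_eq_formMatrix (h : ContDiffOn ℝ 2 φ Ω) (ho : IsOpen Ω) (hx : x ∈ Ω)
    (b : κ → Eucl n × ℝ) :
    borderedHessian φ b x = formMatrix (borderedForm (∇ φ x) (hessian φ x)) b := by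
  ext i j
  simp [borderedHessian, formMatrix, borderedForm, inner_hessian_eq_dirDeriv h ho hx]
  rfl

theorem borderedHessian_isSymm (h : ContDiffOn ℝ 2 φ Ω) (ho : IsOpen Ω) (hx : x ∈ Ω)
    (b : κ → Eucl n × ℝ) : (borderedHessian φ b x).IsSymm := by
  ext i j
  simp only [borderedHessian, Matrix.transpose_apply, Matrix.of_apply]
  rw [dirDeriv_comm h ho hx]
  ring

theorem borderedHessian_congr (ho : IsOpen Ω) (h : EqOn φ ψ Ω) (hx : x ∈ Ω)
    (b : κ → Eucl n × ℝ) : borderedHessian φ b x = borderedHessian ψ b x := by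
  ext i j
  simp only [borderedHessian, Matrix.of_apply]
  rw [dirDeriv_congr ho (dirDeriv_congr ho h _) _ hx, dirDeriv_congr ho h _ hx,
    dirDeriv_congr ho h _ hx]

theorem borderedHessian_sum {ι : Type*} (s : Finset ι) {f : ι → Eucl n → ℝ}
    (hf : ∀ i ∈ s, ContDiffOn ℝ 2 (f i) Ω) (ho : IsOpen Ω) (hx : x ∈ Ω) (b : κ → Eucl n × ℝ) :
    borderedHessian (fun y => ∑ i ∈ s, f i y) b x = ∑ i ∈ s, borderedHessian (f i) b x := by
  have h1 : ∀ v, EqOn (dirDeriv v fun y => ∑ i ∈ s, f i y)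
      (fun y => ∑ i ∈ s, dirDeriv v (f i) y) Ω := fun v y hy =>
    dirDeriv_sum_right s (fun i hi => (hf i hi).of_le (by norm_num)) ho hy v
  ext i j
  simp only [borderedHessian, Matrix.of_apply, Matrix.sum_apply]
  rw [dirDeriv_congr ho (h1 _) _ hx, h1 _ hx, h1 _ hx,
    dirDeriv_sum_right s (fun i hi => (hf i hi).dirDeriv ho (by norm_num) _) ho hx]
  simp only [Finset.mul_sum, Finset.sum_add_distrib]

/-- The family b is constant and derivatives commute, so differentiating the matrix amounts to
differentiating φ. -/
theorem hasDerivAt_borderedHessian (h : ContDiffOn ℝ 3 φ Ω) (ho : IsOpen Ω) (b : κ → Eucl n × ℝ)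
    (v : Eucl n) {s : ℝ} (hx : x + s • v ∈ Ω) (i j : κ) :
    HasDerivAt (fun s => borderedHessian φ b (x + s • v) i j)
      (borderedHessian (dirDeriv v φ) b (x + s • v) i j) s := by
  have h2 : ∀ w, ContDiffOn ℝ 2 (_root_.dirDeriv w φ) Ω := fun w => h.dirDeriv ho (by norm_num) w
  have e1 : ∀ w, EqOn (_root_.dirDeriv w (_root_.dirDeriv v φ))
      (_root_.dirDeriv v (_root_.dirDeriv w φ)) Ω := fun w y hy =>
    dirDeriv_comm (h.of_le (by norm_num)) ho hy w v
  simp only [borderedHessian, Matrix.of_apply]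
  rw [dirDeriv_congr ho (e1 _) _ hx, e1 _ hx, e1 _ hx, dirDeriv_comm (h2 _) ho hx]
  exact ((hasDerivAt_comp_line ((h2 _).dirDeriv ho (by norm_num) _) ho v hx).add
    ((hasDerivAt_comp_line ((h2 _).of_le (by norm_num)) ho v hx).const_mul _)).add
    ((hasDerivAt_comp_line ((h2 _).of_le (by norm_num)) ho v hx).const_mul _)

end borderedHessian

section secondOrder

variable {n : ℕ} {Ω : Set (Eucl n)} {u : Eucl n → ℝ} {x₀ : Eucl n} {κ ι : Type*} [Fintype κ]
  [DecidableEq κ] [Fintype ι]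

/-- The first and second order conditions at a local minimum of
`log |det B| + c log ∑ (∂_i u)²`, where `B` is the bordered Hessian. -/
theorem second_order_conditions_of_isLocalMin (ho : IsOpen Ω) (hx₀ : x₀ ∈ Ω)
    (hu : ContDiffOn ℝ 4 u Ω) (b : κ → Eucl n × ℝ) (e : ι → Eucl n) {c : ℝ}
    (hdet : (borderedHessian u b x₀).det ≠ 0) (hq : ∑ j, dirDeriv (e j) u x₀ ^ 2 ≠ 0)
    (hmin : IsLocalMin (fun x => Real.log (borderedHessian u b x).det +
      c * Real.log (∑ j, dirDeriv (e j) u x ^ 2)) x₀) (v : Eucl n) :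
    ((borderedHessian u b x₀)⁻¹ * borderedHessian (dirDeriv v u) b x₀).trace +
      c * ((∑ j, 2 * dirDeriv (e j) u x₀ * dirDeriv v (dirDeriv (e j) u) x₀) /
        ∑ j, dirDeriv (e j) u x₀ ^ 2) = 0 ∧
    0 ≤ ((borderedHessian u b x₀)⁻¹ * borderedHessian (dirDeriv v (dirDeriv v u)) b x₀).trace -
      ((borderedHessian u b x₀)⁻¹ * borderedHessian (dirDeriv v u) b x₀ *
        ((borderedHessian u b x₀)⁻¹ * borderedHessian (dirDeriv v u) b x₀)).trace +
      c * (((∑ j, (2 * dirDeriv v (dirDeriv (e j) u) x₀ ^ 2 +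
          2 * dirDeriv (e j) u x₀ * dirDeriv v (dirDeriv v (dirDeriv (e j) u)) x₀)) *
          (∑ j, dirDeriv (e j) u x₀ ^ 2) -
          (∑ j, 2 * dirDeriv (e j) u x₀ * dirDeriv v (dirDeriv (e j) u) x₀) ^ 2) /
        (∑ j, dirDeriv (e j) u x₀ ^ 2) ^ 2) := by
  have hu1 : ∀ w, ContDiffOn ℝ 3 (dirDeriv w u) Ω := fun w => hu.dirDeriv ho (by norm_num) w
  have hu2 : ∀ v w, ContDiffOn ℝ 2 (dirDeriv v (dirDeriv w u)) Ω := fun v w =>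
    (hu1 w).dirDeriv ho (by norm_num) v
  have hB : ∀ s : ℝ, x₀ + s • v ∈ Ω → ∀ i j,
      HasDerivAt (fun s => borderedHessian u b (x₀ + s • v) i j)
        (borderedHessian (dirDeriv v u) b (x₀ + s • v) i j) s := fun s hs i j =>
    hasDerivAt_borderedHessian (hu.of_le (by norm_num)) ho b v hs i j
  have hB' : ∀ s : ℝ, x₀ + s • v ∈ Ω → ∀ i j,
      HasDerivAt (fun s => borderedHessian (dirDeriv v u) b (x₀ + s • v) i j)
        (borderedHessian (dirDeriv v (dirDeriv v u)) b (x₀ + s • v) i j) s := fun s hs i j =>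
    hasDerivAt_borderedHessian (hu1 v) ho b v hs i j
  have hQ : ∀ s : ℝ, x₀ + s • v ∈ Ω →
      HasDerivAt (fun s => ∑ j, dirDeriv (e j) u (x₀ + s • v) ^ 2)
        (∑ j, 2 * dirDeriv (e j) u (x₀ + s • v) *
          dirDeriv v (dirDeriv (e j) u) (x₀ + s • v)) s := fun s hs => by
    refine HasDerivAt.fun_sum fun j _ => ?_
    simpa using (hasDerivAt_comp_line ((hu1 (e j)).of_le (by norm_num)) ho v hs).fun_pow 2
  have hQ' : HasDerivAt (fun s : ℝ => ∑ j, 2 * dirDeriv (e j) u (x₀ + s • v) *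
          dirDeriv v (dirDeriv (e j) u) (x₀ + s • v))
        (∑ j, (2 * dirDeriv v (dirDeriv (e j) u) x₀ ^ 2 +
          2 * dirDeriv (e j) u x₀ * dirDeriv v (dirDeriv v (dirDeriv (e j) u)) x₀)) 0 := by
    have hs : x₀ + (0 : ℝ) • v ∈ Ω := by simpa using hx₀
    refine HasDerivAt.fun_sum fun j _ => ?_
    have h := ((hasDerivAt_comp_line ((hu1 (e j)).of_le (by norm_num)) ho v hs).const_mul 2).fun_mul
      (hasDerivAt_comp_line ((hu2 v (e j)).of_le (by norm_num)) ho v hs)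
    simp only [zero_smul, add_zero] at h
    exact h.congr_deriv (by ring)
  have h0 : x₀ + (0 : ℝ) • v = x₀ := by simp
  have hs0 : x₀ + (0 : ℝ) • v ∈ Ω := by rwa [h0]
  have hline := eventually_line_mem ho hx₀ v
  have hev1 : ∀ᶠ s : ℝ in 𝓝 0, (borderedHessian u b (x₀ + s • v)).det ≠ 0 :=
    (hasDerivAt_det (hB 0 hs0)).continuousAt.eventually_ne (by rwa [h0])
  have hev2 : ∀ᶠ s : ℝ in 𝓝 0, ∑ j, dirDeriv (e j) u (x₀ + s • v) ^ 2 ≠ 0 :=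
    (hQ 0 hs0).continuousAt.eventually_ne (by rwa [h0])
  have hmin' : IsLocalMin (fun s : ℝ => Real.log (borderedHessian u b (x₀ + s • v)).det +
      c * Real.log (∑ j, dirDeriv (e j) u (x₀ + s • v) ^ 2)) 0 := by
    have hcont : ContinuousAt (fun s : ℝ => x₀ + s • v) 0 := by fun_prop
    have : ∀ᶠ y in 𝓝 (x₀ + (0 : ℝ) • v), _ := h0.symm ▸ hmin
    have := hcont.eventually this
    simpa [IsLocalMin, IsMinFilter] using this
  have hd1 : ∀ᶠ s : ℝ in 𝓝 0, HasDerivAt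
      (fun s : ℝ => Real.log (borderedHessian u b (x₀ + s • v)).det +
        c * Real.log (∑ j, dirDeriv (e j) u (x₀ + s • v) ^ 2))
      (((borderedHessian u b (x₀ + s • v))⁻¹ *
        borderedHessian (dirDeriv v u) b (x₀ + s • v)).trace +
      c * ((∑ j, 2 * dirDeriv (e j) u (x₀ + s • v) * dirDeriv v (dirDeriv (e j) u) (x₀ + s • v)) /
        ∑ j, dirDeriv (e j) u (x₀ + s • v) ^ 2)) s := by
    filter_upwards [hline, hev1, hev2] with s hs h1 h2
    exact (hasDerivAt_log_det (hB s hs) h1).fun_add (((hQ s hs).log h2).const_mul c)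
  have hd2 := (hasDerivAt_trace_inv_mul (hB 0 hs0) (hB' 0 hs0) hev1.self_of_nhds).fun_add
    ((hQ'.fun_div (hQ 0 hs0) hev2.self_of_nhds).const_mul c)
  have := hmin'.second_deriv_nonneg hd1 hd2
  simp only [h0] at this
  refine ⟨this.1, this.2.trans_eq ?_⟩
  ring

end secondOrder

/-! ### Principal frames and the differential inequality at an interior minimum -/

/-- An orthonormal frame at a point consisting of principal directions of the level set and the unit
normal `∇u / |∇u|`, in which `-D²u` has the tangential eigenvalues `l`. -/
structure IsPrincipalFrame {n N : ℕ} (u : Eucl n → ℝ) (x : Eucl n)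
    (e : OrthonormalBasis (Fin N ⊕ Unit) ℝ (Eucl n)) (l : Fin N → ℝ) (g : ℝ) : Prop where
  norm_pos : 0 < g
  eigenvalue_pos : ∀ i, 0 < l i
  deriv_tangent : ∀ i, dirDeriv (e (.inl i)) u x = 0
  deriv_normal : dirDeriv (e (.inr ())) u x = g
  hess_tangent : ∀ i j, dirDeriv (e (.inl i)) (dirDeriv (e (.inl j)) u) x = if i = j then -l i else 0

/-- The family of `ℝⁿ × ℝ` in which the bordered Hessian is in normal form. -/
def normalFamily {n N : ℕ} (e : Fin N ⊕ Unit → Eucl n) (ν : Eucl n) (r : ℝ) :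
    Fin N ⊕ Fin 2 → Eucl n × ℝ :=
  Sum.elim (fun i => (e (.inl i), 0)) ![(ν, r), (0, 1)]

section normalFamily

variable {n N : ℕ} (φ : Eucl n → ℝ) (e : Fin N ⊕ Unit → Eucl n) (ν : Eucl n) (r : ℝ) (x : Eucl n)

theorem dirDeriv_zero_left : dirDeriv (0 : Eucl n) φ = fun _ => 0 := by
  funext x
  simp [dirDeriv]

theorem dirDeriv_const (v : Eucl n) (c : ℝ) : dirDeriv v (fun _ => c) x = 0 := by
  simp [dirDeriv]

theorem borderedHessian_normalFamily_inl_inl (i j : Fin N) :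
    borderedHessian φ (normalFamily e ν r) x (.inl i) (.inl j) =
      dirDeriv (e (.inl i)) (dirDeriv (e (.inl j)) φ) x := by
  simp [borderedHessian, normalFamily]

theorem borderedHessian_normalFamily_inl_zero (i : Fin N) :
    borderedHessian φ (normalFamily e ν r) x (.inl i) (.inr 0) =
      dirDeriv (e (.inl i)) (dirDeriv ν φ) x + r * dirDeriv (e (.inl i)) φ x := by
  simp [borderedHessian, normalFamily]

theorem borderedHessian_normalFamily_inl_one (i : Fin N) :
    borderedHessian φ (normalFamily e ν r) x (.inl i) (.inr 1) = dirDeriv (e (.inl i)) φ x := by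
  simp [borderedHessian, normalFamily, dirDeriv_zero_left, dirDeriv_const]

theorem borderedHessian_normalFamily_zero_zero :
    borderedHessian φ (normalFamily e ν r) x (.inr 0) (.inr 0) =
      dirDeriv ν (dirDeriv ν φ) x + 2 * r * dirDeriv ν φ x := by
  simp [borderedHessian, normalFamily]
  ring

theorem borderedHessian_normalFamily_zero_one :
    borderedHessian φ (normalFamily e ν r) x (.inr 0) (.inr 1) = dirDeriv ν φ x := by
  simp [borderedHessian, normalFamily, dirDeriv_zero_left, dirDeriv_const]

theorem borderedHessian_normalFamily_one_one :
    borderedHessian φ (normalFamily e ν r) x (.inr 1) (.inr 1) = 0 := by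
  simp [borderedHessian, normalFamily, dirDeriv_zero_left, dirDeriv_const]

end normalFamily

/-- The minimum principle for `log (|∇u| ^ (N + β) K)`, which up to a constant is
`log |det B| + (β - 2) log |∇u|` with the bordered Hessian `B`. -/
theorem not_isLocalMin_log_bordered {n N : ℕ} [Nonempty (Fin N)] {Ω : Set (Eucl n)}
    {u F : Eucl n → ℝ} {x₀ : Eucl n} (ho : IsOpen Ω) (hx₀ : x₀ ∈ Ω) (hu : ContDiffOn ℝ 4 u Ω)
    (hlap : ∀ x ∈ Ω, (Δ u) x = F x) (hF0 : 0 ≤ F x₀)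
    {e : OrthonormalBasis (Fin N ⊕ Unit) ℝ (Eucl n)} {l : Fin N → ℝ} {g β : ℝ}
    (he : IsPrincipalFrame u x₀ e l g) (hβ : β = 0 ∨ β = -(N + 2))
    (hsrc : -∑ i, dirDeriv (e (.inl i)) (dirDeriv (e (.inl i)) F) x₀ / l i
      + 6 / g * ∑ i, dirDeriv (e (.inl i)) (dirDeriv (e (.inr ())) u) x₀ / l i *
          dirDeriv (e (.inl i)) F x₀
      + β * dirDeriv (e (.inr ())) F x₀ / g
      - 6 * F x₀ * (∑ i, dirDeriv (e (.inl i)) (dirDeriv (e (.inr ())) u) x₀ ^ 2 / l i) / g ^ 2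
        ≤ 0) :
    ∃ b : Fin N ⊕ Fin 2 → Eucl n × ℝ, (borderedHessian u b x₀).det ≠ 0 ∧
      ¬ IsLocalMin (fun x => Real.log (borderedHessian u b x).det +
        (β - 2) / 2 * Real.log (∑ j, dirDeriv (e j) u x ^ 2)) x₀ := by
  have hg := he.norm_pos
  have hg' := hg.ne'
  have hl := he.eigenvalue_pos
  have hl' : ∀ i, l i ≠ 0 := fun i => (hl i).ne'
  have hu1 : ∀ w, ContDiffOn ℝ 3 (dirDeriv w u) Ω := fun w => hu.dirDeriv ho (by norm_num) w
  have hu2 : ∀ v w, ContDiffOn ℝ 2 (dirDeriv v (dirDeriv w u)) Ω := fun v w =>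
    (hu1 w).dirDeriv ho (by norm_num) v
  have hlap' : EqOn F (fun x => ∑ i, dirDeriv (e i) (dirDeriv (e i) u) x) Ω := fun x hx => by
    rw [← hlap x hx, laplacian_eq_sum_dirDeriv (hu.of_le (by norm_num)) ho hx e]
  set w : Fin N → ℝ := fun i => dirDeriv (e (.inl i)) (dirDeriv (e (.inr ())) u) x₀ with hw
  set m := e (.inr ()) with hm
  set a := dirDeriv m (dirDeriv m u) x₀ with ha
  set s := ∑ i, w i ^ 2 / l i with hs
  set H := ∑ i, l i with hH
  -- The tangential correction makes ν orthogonal, for D²u at x₀, to every principal direction. It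
  -- does not change the first derivative, since ∇u has no tangential part.
  set ν : Eucl n := m + ∑ i, (w i / l i) • e (.inl i) with hν
  have hdν : ∀ φ x, dirDeriv ν φ x = dirDeriv m φ x + ∑ i, w i / l i * dirDeriv (e (.inl i)) φ x := by
    intro φ x
    rw [hν, dirDeriv_add_left, dirDeriv_sum_left]
    simp only [dirDeriv_smul_left]
  -- symmetry of the second and third derivatives
  have S2 : ∀ v v', dirDeriv v (dirDeriv v' u) x₀ = dirDeriv v' (dirDeriv v u) x₀ :=
    fun v v' => dirDeriv_comm (hu.of_le (by norm_num)) ho hx₀ v v'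
  have S12 : ∀ v v' v'', dirDeriv v (dirDeriv v' (dirDeriv v'' u)) x₀ =
      dirDeriv v' (dirDeriv v (dirDeriv v'' u)) x₀ := fun v v' v'' =>
    dirDeriv_comm ((hu1 v'').of_le (by norm_num)) ho hx₀ v v'
  have S23 : ∀ v v' v'', dirDeriv v (dirDeriv v' (dirDeriv v'' u)) x₀ =
      dirDeriv v (dirDeriv v'' (dirDeriv v' u)) x₀ := fun v v' v'' =>
    dirDeriv_congr ho (fun y hy => dirDeriv_comm (hu.of_le (by norm_num)) ho hy v' v'') v hx₀
  -- the second derivatives in the frame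
  have ht := he.deriv_tangent
  have hn : dirDeriv m u x₀ = g := he.deriv_normal
  have htt := he.hess_tangent
  have hnt : ∀ i, dirDeriv m (dirDeriv (e (.inl i)) u) x₀ = w i := fun i => S2 _ _
  have htn : ∀ i, dirDeriv (e (.inl i)) (dirDeriv m u) x₀ = w i := fun i => rfl
  have hdνu : dirDeriv ν u x₀ = g := by simp [hdν, ht, hn]
  have hνt : ∀ i, dirDeriv ν (dirDeriv (e (.inl i)) u) x₀ = 0 := by
    intro i
    simp [hdν, hnt, htt, hl']
  have hνm : dirDeriv ν (dirDeriv m u) x₀ = a + s := by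
    rw [hdν, hs]
    congr 1
    exact Finset.sum_congr rfl fun i _ => by rw [htn]; ring
  have hνν : dirDeriv ν (dirDeriv ν u) x₀ = a + s := by
    rw [hdν (dirDeriv ν u), S2 m ν, hνm]
    simp only [S2 _ ν, hνt]
    simp
  have haH : a = F x₀ + H := by
    have := hlap' hx₀
    simp only [Fintype.sum_sum_type, htt] at this
    simp at this
    rw [this, hH]
    ring
  -- Chosen so that the (ν, ν) entry (a + s) + 2rg of the bordered Hessian vanishes.
  set r := -((a + s) / (2 * g)) with hr
  set b := normalFamily e ν r
  have hB : borderedHessian u b x₀ =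
      Matrix.fromBlocks (Matrix.diagonal fun i => -l i) 0 0 !![0, g; g, 0] := by
    have hsymm := borderedHessian_isSymm (hu.of_le (by norm_num)) ho hx₀ b
    have h1 : ∀ i, borderedHessian u b x₀ (.inl i) (.inr 0) = 0 := fun i => by
      rw [borderedHessian_normalFamily_inl_zero, S2, hνt, ht]; simp
    have h2 : ∀ i, borderedHessian u b x₀ (.inl i) (.inr 1) = 0 := fun i => by
      rw [borderedHessian_normalFamily_inl_one, ht]
    have h3 : borderedHessian u b x₀ (.inr 0) (.inr 1) = g := by
      rw [borderedHessian_normalFamily_zero_one, hdνu]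
    ext i j
    rcases i with i | i <;> rcases j with j | j
    · rw [borderedHessian_normalFamily_inl_inl, htt]
      simp [Matrix.diagonal_apply]
    · fin_cases j
      · simpa using h1 i
      · simpa using h2 i
    · rw [← hsymm.apply]
      fin_cases i
      · simpa using h1 j
      · simpa using h2 j
    · fin_cases i <;> fin_cases j
      · simp only [Fin.zero_eta, borderedHessian_normalFamily_zero_zero, b, hνν, hdνu, hr]
        simp
        field_simp
        ring
      · simpa using h3
      · simpa using (hsymm.apply _ _).trans h3
      · simpa using borderedHessian_normalFamily_one_one u e ν r x₀
  have hBinv := inv_fromBlocks_diagonal_antidiag hl' hg'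
  rw [← hB] at hBinv
  have hdet : (borderedHessian u b x₀).det ≠ 0 := by
    rw [hB, Matrix.det_fromBlocks_zero₂₁, Matrix.det_diagonal, Matrix.det_fin_two_of]
    refine mul_ne_zero (Finset.prod_ne_zero_iff.mpr fun i _ => neg_ne_zero.mpr (hl' i)) ?_
    simp [hg']
  have hq : ∑ j, dirDeriv (e j) u x₀ ^ 2 = g ^ 2 := by
    simp [Fintype.sum_sum_type, ht, ← hm, hn]
  refine ⟨b, hdet, fun hmin => ?_⟩
  have key := second_order_conditions_of_isLocalMin ho hx₀ hu b e hdet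
    (by rw [hq]; positivity) hmin
  rw [hBinv, hq] at key
  have hsymm : ∀ v, (borderedHessian (dirDeriv v u) b x₀).IsSymm := fun v =>
    borderedHessian_isSymm ((hu1 v).of_le (by norm_num)) ho hx₀ b
  have hTν : ∀ i v, dirDeriv (e (.inl i)) (dirDeriv ν (dirDeriv v u)) x₀ =
      dirDeriv (e (.inl i)) (dirDeriv m (dirDeriv v u)) x₀ +
        ∑ k, w k / l k * dirDeriv (e (.inl i)) (dirDeriv (e (.inl k)) (dirDeriv v u)) x₀ := by
    intro i v
    rw [S12, hdν, S12]
    simp only [S12 (e (.inl i)) (e (.inl _))]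
  set t : Fin N → Fin N → Fin N → ℝ := fun i j k =>
    dirDeriv (e (.inl i)) (dirDeriv (e (.inl j)) (dirDeriv (e (.inl k)) u)) x₀
  set X : Fin N → Fin N → ℝ := fun i j =>
    dirDeriv (e (.inl i)) (dirDeriv (e (.inl j)) (dirDeriv m u)) x₀
  -- the first order condition in the normal direction
  have hX : ∑ i, X i i / l i = (2 * s + β * a) / g := by
    have k1 := (key m).1
    rw [trace_mul_fromBlocks _ (hsymm m)] at k1
    simp only [borderedHessian_normalFamily_inl_inl, borderedHessian_normalFamily_zero_one, b,
      hνm, Fintype.sum_sum_type, ht, ← hm, hn] at k1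
    simp only [mul_zero, zero_mul, Finset.sum_const_zero, zero_add, Finset.univ_unique,
      Finset.sum_singleton, PUnit.default_eq_unit, ← ha] at k1
    have : ∑ i, X i i / l i = 2 * (a + s) / g + (β - 2) / 2 * (2 * g * a / g ^ 2) := by
      linarith [k1]
    rw [this]
    field_simp
    ring
  -- the second order condition in the tangential directions
  have hγ : ∀ γ, 0 ≤ (Matrix.fromBlocks (Matrix.diagonal fun i => -(l i)⁻¹) 0 0 !![0, g⁻¹; g⁻¹, 0] *
      borderedHessian (dirDeriv (e (.inl γ)) (dirDeriv (e (.inl γ)) u)) b x₀).trace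
      - (∑ i, ∑ j, t i j γ ^ 2 / (l i * l j) +
        4 / g * (X γ γ + ∑ k, w k / l k * t γ k γ + (a + s) * l γ / (2 * g)))
      + (β - 2) * (l γ ^ 2 - w γ ^ 2 + g * X γ γ) / g ^ 2 := by
    intro γ
    have k2 := (key (e (.inl γ))).2
    rw [trace_mul_fromBlocks_sq _ (hsymm _) (borderedHessian_normalFamily_one_one _ _ _ _ _)] at k2
    simp only [borderedHessian_normalFamily_inl_inl, borderedHessian_normalFamily_zero_one,
      borderedHessian_normalFamily_inl_zero, borderedHessian_normalFamily_inl_one, b, hνt,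
      htt, hTν] at k2
    have e1 : ∑ i, (dirDeriv (e (.inl i)) (dirDeriv m (dirDeriv (e (.inl γ)) u)) x₀ +
        ∑ k, w k / l k * dirDeriv (e (.inl i)) (dirDeriv (e (.inl k)) (dirDeriv (e (.inl γ)) u)) x₀
        + r * (if i = γ then -l i else 0)) * (if i = γ then -l i else 0) / l i =
        -(X γ γ + ∑ k, w k / l k * t γ k γ + (a + s) * l γ / (2 * g)) := by
      rw [Finset.sum_eq_single γ (fun i _ hi => by simp [hi]) (by simp), S23, hr]
      simp only [if_true, X, t]
      have := hl' γ
      field_simp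
    have e2 : ∑ j, (2 * dirDeriv (e (.inl γ)) (dirDeriv (e j) u) x₀ ^ 2 + 2 * dirDeriv (e j) u x₀ *
        dirDeriv (e (.inl γ)) (dirDeriv (e (.inl γ)) (dirDeriv (e j) u)) x₀) =
        2 * l γ ^ 2 + 2 * w γ ^ 2 + 2 * g * X γ γ := by
      simp [Fintype.sum_sum_type, ht, hn, htt, htn, ← hm, ite_pow, X]
      ring
    have e3 : ∑ j, 2 * dirDeriv (e j) u x₀ * dirDeriv (e (.inl γ)) (dirDeriv (e j) u) x₀ =
        2 * g * w γ := by
      simp [Fintype.sum_sum_type, ht, hn, htn, ← hm]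
    rw [e1, e2, e3] at k2
    refine k2.trans_eq ?_
    simp only [t]
    field_simp
    ring
  -- the second order condition in the normal direction
  set Y : Fin N → ℝ := fun i => dirDeriv (e (.inl i)) (dirDeriv m (dirDeriv m u)) x₀
  set Z := dirDeriv m (dirDeriv m (dirDeriv m u)) x₀ with hZ
  have hν2 : 0 ≤ (Matrix.fromBlocks (Matrix.diagonal fun i => -(l i)⁻¹) 0 0 !![0, g⁻¹; g⁻¹, 0] *
      borderedHessian (dirDeriv m (dirDeriv m u)) b x₀).trace
      - (∑ i, ∑ j, X i j ^ 2 / (l i * l j)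
        - 4 / g * (∑ i, w i / l i * Y i + ∑ i, ∑ j, w i / l i * X i j * (w j / l j)
          - (a + s) * s / (2 * g)) + 2 * (a + s) ^ 2 / g ^ 2)
      + (β - 2) * (∑ i, w i ^ 2 - a ^ 2 + g * Z) / g ^ 2 := by
    have k2 := (key m).2
    rw [trace_mul_fromBlocks_sq _ (hsymm _) (borderedHessian_normalFamily_one_one _ _ _ _ _)] at k2
    simp only [borderedHessian_normalFamily_inl_inl, borderedHessian_normalFamily_zero_one,
      borderedHessian_normalFamily_inl_zero, borderedHessian_normalFamily_inl_one, b, hνm,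
      htn, hTν] at k2
    have e1 : ∑ i, (dirDeriv (e (.inl i)) (dirDeriv m (dirDeriv m u)) x₀ +
        ∑ k, w k / l k * dirDeriv (e (.inl i)) (dirDeriv (e (.inl k)) (dirDeriv m u)) x₀
        + r * w i) * w i / l i =
        ∑ i, w i / l i * Y i + ∑ i, ∑ j, w i / l i * X i j * (w j / l j)
          - (a + s) * s / (2 * g) := by
      have : (a + s) * s / (2 * g) = -∑ i, r * w i * (w i / l i) := by
        rw [hs, hr, Finset.mul_sum, Finset.sum_div, ← Finset.sum_neg_distrib]
        exact Finset.sum_congr rfl fun i _ => by ring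
      rw [this, sub_neg_eq_add, ← Finset.sum_add_distrib, ← Finset.sum_add_distrib]
      refine Finset.sum_congr rfl fun i _ => ?_
      have : ∑ j, w i / l i * X i j * (w j / l j) = w i / l i * ∑ k, w k / l k * X i k := by
        rw [Finset.mul_sum]
        exact Finset.sum_congr rfl fun j _ => by ring
      rw [this]
      simp only [X, Y]
      ring
    have e2 : ∑ j, (2 * dirDeriv m (dirDeriv (e j) u) x₀ ^ 2 + 2 * dirDeriv (e j) u x₀ *
        dirDeriv m (dirDeriv m (dirDeriv (e j) u)) x₀) =
        2 * ∑ i, w i ^ 2 + 2 * a ^ 2 + 2 * g * Z := by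
      simp [Fintype.sum_sum_type, ht, hn, hnt, ← hm, Finset.mul_sum, ← ha, ← hZ]
      ring
    have e3 : ∑ j, 2 * dirDeriv (e j) u x₀ * dirDeriv m (dirDeriv (e j) u) x₀ = 2 * g * a := by
      simp [Fintype.sum_sum_type, ht, hn, ← hm, ← ha]
    rw [e1, e2, e3] at k2
    refine k2.trans_eq ?_
    field_simp
    ring
  -- the derivatives of the Laplacian
  have hF1 : ∀ v, dirDeriv v F x₀ = ∑ k, dirDeriv v (dirDeriv (e (.inl k))
      (dirDeriv (e (.inl k)) u)) x₀ + dirDeriv v (dirDeriv m (dirDeriv m u)) x₀ := by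
    intro v
    rw [dirDeriv_congr ho hlap' v hx₀, dirDeriv_sum_right _
      (fun i _ => (hu2 _ _).of_le (by norm_num)) ho hx₀]
    simp [Fintype.sum_sum_type, ← hm]
  have hFm : dirDeriv m F x₀ = ∑ k, X k k + Z := by
    rw [hF1]
    congr 1
    exact Finset.sum_congr rfl fun k _ => by rw [S12, S23]
  have hFt : ∀ i, dirDeriv (e (.inl i)) F x₀ = ∑ k, t i k k + Y i := fun i => hF1 _
  -- By linearity of the bordered Hessian, the traces over the frame add up to tr(B⁻¹ B(F)). The
  -- vector ν contributes the term with w.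
  have htrace : ∑ γ, (Matrix.fromBlocks (Matrix.diagonal fun i => -(l i)⁻¹) 0 0 !![0, g⁻¹; g⁻¹, 0] *
      borderedHessian (dirDeriv (e (.inl γ)) (dirDeriv (e (.inl γ)) u)) b x₀).trace +
      (Matrix.fromBlocks (Matrix.diagonal fun i => -(l i)⁻¹) 0 0 !![0, g⁻¹; g⁻¹, 0] *
      borderedHessian (dirDeriv m (dirDeriv m u)) b x₀).trace =
      -∑ i, dirDeriv (e (.inl i)) (dirDeriv (e (.inl i)) F) x₀ / l i +
        2 * (dirDeriv m F x₀ + ∑ i, w i / l i * dirDeriv (e (.inl i)) F x₀) / g := by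
    have hFsymm : (borderedHessian F b x₀).IsSymm := borderedHessian_isSymm
      ((ContDiffOn.sum fun i _ => hu2 (e i) (e i)).congr hlap') ho hx₀ b
    have h1 := trace_mul_fromBlocks (l := l) (g := g) _ hFsymm
    simp only [borderedHessian_normalFamily_inl_inl, borderedHessian_normalFamily_zero_one, b,
      hdν] at h1
    rw [← h1, borderedHessian_congr ho hlap' hx₀, borderedHessian_sum _ (fun i _ => hu2 _ _) ho hx₀,
      Matrix.mul_sum, Matrix.trace_sum, Fintype.sum_sum_type]
    simp [← hm, b]
  have hsum := add_nonneg (Finset.sum_nonneg fun γ (_ : γ ∈ Finset.univ) => hγ γ) hν2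
  have h3 := third_order_terms_lt hl hg hF0 hH hs haH (by simpa using hβ)
    (fun i j k => S12 _ _ _) (fun i j k => S23 _ _ _) hX (t := t)
  have c1 : ∑ γ, ∑ i, ∑ j, t i j γ ^ 2 / (l i * l j) =
      ∑ i, ∑ j, ∑ k, t i j k ^ 2 / (l i * l j) := by
    rw [Finset.sum_comm]
    exact Finset.sum_congr rfl fun i _ => Finset.sum_comm
  have c2 : ∑ γ, ∑ k, w k / l k * t γ k γ = ∑ j, w j / l j * ∑ i, t i i j := by
    rw [Finset.sum_comm]
    simp only [Finset.mul_sum]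
    exact Finset.sum_congr rfl fun i _ => Finset.sum_congr rfl fun j _ => by
      rw [show t j i j = t j j i from S23 _ _ _]
  -- The derivatives Y_i, twice normal, are not controlled by any square. The differentiated
  -- equation Δu = F trades them for ∂_i F and purely tangential derivatives. This is why the cross
  -- term of the cubic inequality has coefficient 8/g and why ∂_i F enters with 6/g.
  have c3 : ∑ i, w i / l i * Y i = ∑ i, w i / l i * dirDeriv (e (.inl i)) F x₀ -
      ∑ j, w j / l j * ∑ i, t i i j := by
    rw [← Finset.sum_sub_distrib]
    refine Finset.sum_congr rfl fun i _ => ?_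
    rw [hFt, ← mul_sub]
    congr 1
    have : ∑ k, t i k k = ∑ k, t k k i := Finset.sum_congr rfl fun k _ => by
      simp only [t]; rw [S12, S23]
    rw [this]
    ring
  have c4 : ∑ γ, (a + s) * l γ / (2 * g) = (a + s) * H / (2 * g) := by
    rw [hH, Finset.mul_sum, Finset.sum_div]
  have c5 : ∑ γ, (β - 2) * (l γ ^ 2 - w γ ^ 2 + g * X γ γ) / g ^ 2 =
      (β - 2) * (∑ i, l i ^ 2 - ∑ i, w i ^ 2 + g * ∑ i, X i i) / g ^ 2 := by
    rw [← Finset.sum_div, ← Finset.mul_sum, Finset.sum_add_distrib, Finset.sum_sub_distrib,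
      Finset.mul_sum]
  rw [Finset.sum_add_distrib, Finset.sum_sub_distrib, Finset.sum_add_distrib, ← Finset.mul_sum,
    Finset.sum_add_distrib, Finset.sum_add_distrib, c1, c2, c3, c4, c5] at hsum
  rw [hFm] at htrace hsrc
  set G2 := ∑ i, dirDeriv (e (.inl i)) (dirDeriv (e (.inl i)) F) x₀ / l i
  set G1 := ∑ i, w i / l i * dirDeriv (e (.inl i)) F x₀
  have d1 : (β - 2) * (∑ i, l i ^ 2 - ∑ i, w i ^ 2 + g * ∑ i, X i i) / g ^ 2 +
      (β - 2) * (∑ i, w i ^ 2 - a ^ 2 + g * Z) / g ^ 2 =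
      (β - 2) * (∑ i, l i ^ 2 - a ^ 2) / g ^ 2 + (β - 2) * (∑ i, X i i + Z) / g := by
    field_simp
    ring
  have d2 : 4 / g * ((a + s) * H / (2 * g)) + 4 / g * ((a + s) * s / (2 * g)) +
      2 * (a + s) ^ 2 / g ^ 2 = 2 * (a + s) / g ^ 2 * (H + s + (a + s)) := by
    field_simp
    ring
  have d3 : (β - 2) * (∑ i, X i i + Z) / g + 2 * (∑ i, X i i + Z + G1) / g =
      β * (∑ i, X i i + Z) / g + 2 / g * G1 := by
    field_simp
    ring
  have d4 : 6 / g * G1 = 2 / g * G1 + 4 / g * G1 := by ring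
  have d5 : 8 / g * ∑ j, w j / l j * ∑ i, t i i j = 4 / g * ∑ j, w j / l j * ∑ i, t i i j +
      4 / g * ∑ j, w j / l j * ∑ i, t i i j := by ring
  rw [d4] at hsrc
  rw [d5] at h3
  generalize ∑ j, w j / l j * ∑ i, t i i j = q₁ at hsum h3
  generalize ∑ i, ∑ j, w i / l i * X i j * (w j / l j) = q₂ at hsum h3
  generalize ∑ i, ∑ j, X i j ^ 2 / (l i * l j) = q₃ at hsum h3
  generalize ∑ i, ∑ j, ∑ k, t i j k ^ 2 / (l i * l j) = q₄ at hsum h3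
  obtain ⟨τ, hτ⟩ : ∃ τ : (Eucl n → ℝ) → ℝ, ∀ φ, (Matrix.fromBlocks
      (Matrix.diagonal fun i => -(l i)⁻¹) 0 0 !![0, g⁻¹; g⁻¹, 0] *
      borderedHessian φ b x₀).trace = τ φ := ⟨_, fun _ => rfl⟩
  simp only [hτ] at hsum htrace
  have hexp := hsum.trans_eq (c := ∑ γ, τ (dirDeriv (e (.inl γ)) (dirDeriv (e (.inl γ)) u)) +
      τ (dirDeriv m (dirDeriv m u)) - (q₄ + (4 / g * q₁ + 4 / g * q₁) + q₃ +
      4 / g * ∑ i, X i i - 4 / g * q₂) + 4 / g * G1 - (4 / g * ((a + s) * H / (2 * g)) +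
      4 / g * ((a + s) * s / (2 * g)) + 2 * (a + s) ^ 2 / g ^ 2) +
      ((β - 2) * (∑ i, l i ^ 2 - ∑ i, w i ^ 2 + g * ∑ i, X i i) / g ^ 2 +
      (β - 2) * (∑ i, w i ^ 2 - a ^ 2 + g * Z) / g ^ 2)) (by ring)
  rw [htrace, d1, d2] at hexp
  linarith [hexp, h3, hsrc, d3]

/-! ### From the bordered determinant to the curvature function -/

theorem hessian_inner_comm {n : ℕ} {Ω : Set (Eucl n)} {u : Eucl n → ℝ} {x : Eucl n}
    (hu : ContDiffOn ℝ 2 u Ω) (ho : IsOpen Ω) (hx : x ∈ Ω) (v w : Eucl n) :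
    ⟪hessian u x v, w⟫_ℝ = ⟪hessian u x w, v⟫_ℝ := by
  rw [inner_hessian_eq_dirDeriv hu ho hx, inner_hessian_eq_dirDeriv hu ho hx,
    dirDeriv_comm hu ho hx]

theorem shapeOperator_isSymmetric {n : ℕ} {p : Eucl n} {A : Eucl n →L[ℝ] Eucl n}
    (hA : ∀ v w, ⟪A v, w⟫_ℝ = ⟪A w, v⟫_ℝ) : (shapeOperator p A).IsSymmetric := by
  intro v w
  rw [real_inner_comm, inner_shapeOperator, inner_shapeOperator, hA]

/-- The spectral theorem for the symmetric shape operator. Its eigenvalues k_i are positive by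
strict convexity, and l_i = |∇u| k_i. -/
theorem exists_isPrincipalFrame {n N : ℕ} (hn : n = N + 1) {Ω : Set (Eucl n)} {u : Eucl n → ℝ}
    {x : Eucl n} (hu : ContDiffOn ℝ 2 u Ω) (ho : IsOpen Ω) (hx : x ∈ Ω) (hp : ∇ u x ≠ 0)
    (hconv : IsStrictlyConvexLevel (∇ u x) (hessian u x)) :
    ∃ (e : OrthonormalBasis (Fin N ⊕ Unit) ℝ (Eucl n)) (l : Fin N → ℝ),
      IsPrincipalFrame u x e l ‖∇ u x‖ ∧
        0 < LinearMap.det (shapeOperator (∇ u x) (hessian u x)) := by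
  have : Fact (Module.finrank ℝ (Eucl n) = N + 1) := ⟨by simp [hn]⟩
  have hS := shapeOperator_isSymmetric (p := ∇ u x) (hessian_inner_comm hu ho hx)
  have hfin : Module.finrank ℝ (ℝ ∙ (∇ u x))ᗮ = N :=
    Submodule.finrank_orthogonal_span_singleton hp
  set c := hS.eigenvectorBasis hfin
  set k := hS.eigenvalues hfin
  have hg : 0 < ‖∇ u x‖ := norm_pos_iff.mpr hp
  have hSc : ∀ i, shapeOperator (∇ u x) (hessian u x) (c i) = k i • c i := fun i =>
    hS.apply_eigenvectorBasis hfin i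
  have hcc := orthonormal_iff_ite.mp c.orthonormal
  have hkpos : ∀ i, 0 < k i := by
    intro i
    have h := hconv (c i) (c.orthonormal.ne_zero i)
    rw [hSc, inner_smul_left, hcc] at h
    simpa using h
  obtain ⟨e, he, hen⟩ := exists_orthonormalBasis_extending hn hp c
  refine ⟨e, fun i => ‖∇ u x‖ * k i, ⟨hg, fun i => mul_pos hg (hkpos i), fun i => ?_, ?_,
    fun i j => ?_⟩, ?_⟩
  · rw [← inner_gradient_eq_dirDeriv, he]
    exact Submodule.mem_orthogonal_singleton_iff_inner_right.mp (c i).2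
  · rw [← inner_gradient_eq_dirDeriv, hen, inner_smul_right, real_inner_self_eq_norm_sq]
    field_simp
  · rw [← inner_hessian_eq_dirDeriv hu ho hx, he, he]
    have h := inner_shapeOperator (∇ u x) (hessian u x) (c i) (c j)
    rw [hSc, inner_smul_right, hcc] at h
    have h2 : ⟪hessian u x (c i), (c j : Eucl n)⟫_ℝ = -(‖∇ u x‖ * (k i * if j = i then 1 else 0)) := by
      rw [h]
      field_simp
    rw [h2]
    by_cases hij : i = j
    · subst hij; simp
    · simp [hij, Ne.symm hij]
  · rw [hS.det_eq_prod_eigenvalues hfin]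
    exact Finset.prod_pos fun i _ => by simpa using hkpos i

/-- The inequality for the right-hand side `F = Δu` at a point, in every frame of principal
directions, under which `|∇u| ^ (N + β) K` has no local minimum there. -/
def SourceCondition {n : ℕ} (N : ℕ) (β : ℝ) (u F : Eucl n → ℝ) (x : Eucl n) : Prop :=
  ∀ (e : OrthonormalBasis (Fin N ⊕ Unit) ℝ (Eucl n)) (l : Fin N → ℝ) (g : ℝ),
    IsPrincipalFrame u x e l g →
    -∑ i, dirDeriv (e (.inl i)) (dirDeriv (e (.inl i)) F) x / l i
      + 6 / g * ∑ i, dirDeriv (e (.inl i)) (dirDeriv (e (.inr ())) u) x / l i *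
          dirDeriv (e (.inl i)) F x
      + β * dirDeriv (e (.inr ())) F x / g
      - 6 * F x * (∑ i, dirDeriv (e (.inl i)) (dirDeriv (e (.inr ())) u) x ^ 2 / l i) / g ^ 2
        ≤ 0

/-- `Real.log` ignores signs, so (-1)^(N+1) disappears, and the constant matrix P contributes only
an additive constant. -/
theorem log_det_borderedHessian {n N : ℕ} (hn : n = N + 1) {Ω : Set (Eucl n)} {u : Eucl n → ℝ}
    {x : Eucl n} (hu : ContDiffOn ℝ 2 u Ω) (ho : IsOpen Ω) (hx : x ∈ Ω) (hp : ∇ u x ≠ 0)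
    (e : OrthonormalBasis (Fin N ⊕ Unit) ℝ (Eucl n)) {b : Fin N ⊕ Fin 2 → Eucl n × ℝ}
    {P : Matrix (Fin N ⊕ Fin 2) (Fin N ⊕ Fin 2) ℝ} (hP : P.det ≠ 0)
    (hb : ∀ i, b i = ∑ j, P i j • extendedFrame e j)
    (hK : LinearMap.det (shapeOperator (∇ u x) (hessian u x)) ≠ 0) :
    Real.log (borderedHessian u b x).det = Real.log (P.det ^ 2) + (N + 2) * Real.log ‖∇ u x‖ +
      Real.log (LinearMap.det (shapeOperator (∇ u x) (hessian u x))) := by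
  have hp' : ‖∇ u x‖ ≠ 0 := norm_ne_zero_iff.mpr hp
  rw [borderedHessian_eq_formMatrix hu ho hx, det_formMatrix_eq _ hb,
    det_formMatrix_borderedForm hn hp, Real.log_mul (pow_ne_zero _ hP)
    (mul_ne_zero (mul_ne_zero (by simp) (pow_ne_zero _ hp')) hK), Real.log_mul
    (mul_ne_zero (by simp) (pow_ne_zero _ hp')) hK, Real.log_mul (by simp) (pow_ne_zero _ hp'),
    Real.log_pow (n := N + 1), Real.log_pow (n := N + 2)]
  simp [add_assoc]

theorem sum_dirDeriv_sq {n : ℕ} {ι : Type*} [Fintype ι] (u : Eucl n → ℝ) (x : Eucl n)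
    (e : OrthonormalBasis ι ℝ (Eucl n)) : ∑ j, dirDeriv (e j) u x ^ 2 = ‖∇ u x‖ ^ 2 := by
  rw [← real_inner_self_eq_norm_sq, ← e.sum_inner_mul_inner]
  exact Finset.sum_congr rfl fun j _ => by
    rw [← inner_gradient_eq_dirDeriv, real_inner_comm (∇ u x), sq]

theorem not_isLocalMin_of_log_eq {n N : ℕ} (hn : n = N + 1) (hN : 1 ≤ N) {Ω : Set (Eucl n)}
    {u F ψ : Eucl n → ℝ} {x₀ : Eucl n} (ho : IsOpen Ω) (hx₀ : x₀ ∈ Ω) (hu : ContDiffOn ℝ 4 u Ω)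
    (hlap : ∀ x ∈ Ω, (Δ u) x = F x) (hF0 : 0 ≤ F x₀) (hgrad : ∀ x ∈ Ω, ∇ u x ≠ 0)
    (hconv : ∀ x ∈ Ω, IsStrictlyConvexLevel (∇ u x) (hessian u x)) {β : ℝ}
    (hβ : β = 0 ∨ β = -(N + 2)) (hsrc : SourceCondition N β u F x₀)
    (hψ : ∀ x ∈ Ω, 0 < ψ x ∧ Real.log (ψ x) = (N + β) * Real.log ‖∇ u x‖ +
      Real.log (LinearMap.det (shapeOperator (∇ u x) (hessian u x)))) :
    ¬ IsLocalMin ψ x₀ := by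
  intro hmin
  have : Nonempty (Fin N) := ⟨⟨0, hN⟩⟩
  have hu2 : ContDiffOn ℝ 2 u Ω := hu.of_le (by norm_num)
  have hK : ∀ x ∈ Ω, 0 < LinearMap.det (shapeOperator (∇ u x) (hessian u x)) := fun x hx =>
    (exists_isPrincipalFrame hn hu2 ho hx (hgrad x hx) (hconv x hx)).choose_spec.choose_spec.2
  obtain ⟨e, l, he, -⟩ := exists_isPrincipalFrame hn hu2 ho hx₀ (hgrad x₀ hx₀) (hconv x₀ hx₀)
  obtain ⟨b, hb, hno⟩ := not_isLocalMin_log_bordered ho hx₀ hu hlap hF0 he hβ (hsrc e l _ he)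
  obtain ⟨P, hP⟩ := exists_coord_extendedFrame e b
  -- The family b is a basis because det P ^ 2 divides the nonzero bordered determinant.
  have hPdet : P.det ≠ 0 := by
    intro h
    rw [borderedHessian_eq_formMatrix hu2 ho hx₀, det_formMatrix_eq _ hP, h] at hb
    simp at hb
  have hlog : ∀ x ∈ Ω, Real.log (borderedHessian u b x).det +
      (β - 2) / 2 * Real.log (∑ j, dirDeriv (e j) u x ^ 2) =
      Real.log (P.det ^ 2) + Real.log (ψ x) := by
    intro x hx
    rw [log_det_borderedHessian hn hu2 ho hx (hgrad x hx) e hPdet hP (hK x hx).ne',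
      sum_dirDeriv_sq, (hψ x hx).2, Real.log_pow ‖∇ u x‖ 2]
    push_cast
    ring
  refine hno ?_
  filter_upwards [hmin, ho.mem_nhds hx₀] with x hx hxΩ
  rw [hlog x hxΩ, hlog x₀ hx₀]
  gcongr
  exact (hψ x₀ hx₀).1

/-! ### The source condition for f(u) and for f(x) -/

/-- Since u has no first tangential derivatives at x, F_i = 0, F_ii = -f' l_i and F_ν = f' g there.
The expression is therefore (N+β) f' minus a nonnegative multiple of F. -/
theorem sourceCondition_of_comp {n N : ℕ} {Ω : Set (Eucl n)} {u F : Eucl n → ℝ} {x : Eucl n}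
    (ho : IsOpen Ω) (hx : x ∈ Ω) (hu : ContDiffOn ℝ 2 u Ω) {f : ℝ → ℝ} (hf : ContDiff ℝ 2 f)
    (hF : ∀ y ∈ Ω, F y = f (u y)) (hF0 : 0 ≤ F x) {β : ℝ}
    (hβ : (N + β) * deriv f (u x) ≤ 0) : SourceCondition N β u F x := by
  intro e l g he
  have hdu : ∀ y ∈ Ω, DifferentiableAt ℝ u y := fun y hy =>
    (hu.differentiableOn (by norm_num)).differentiableAt (ho.mem_nhds hy)
  have h1 : ∀ v, EqOn (dirDeriv v F) (fun y => deriv f (u y) * dirDeriv v u y) Ω := by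
    intro v y hy
    rw [dirDeriv_congr ho (fun y hy => hF y hy) v hy]
    have hfd := ((hf.differentiable (by norm_num)) (u y)).hasDerivAt
    have hd : fderiv ℝ (fun y => f (u y)) y = deriv f (u y) • fderiv ℝ u y :=
      (hfd.comp_hasFDerivAt y (hdu y hy).hasFDerivAt).fderiv
    simp [dirDeriv, hd]
  have h2 : ∀ i, dirDeriv (e (.inl i)) (dirDeriv (e (.inl i)) F) x = -(deriv f (u x) * l i) := by
    intro i
    rw [dirDeriv_congr ho (h1 _) _ hx]
    have hd1 : DifferentiableAt ℝ (fun y => deriv f (u y)) x :=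
      ((((contDiff_succ_iff_deriv (n := 1)).mp hf).2.2.differentiable
        (by norm_num)) (u x)).comp x (hdu x hx)
    have hd2 : DifferentiableAt ℝ (dirDeriv (e (.inl i)) u) x :=
      ((hu.dirDeriv ho (m := 1) (by norm_num) _).differentiableOn
        (by norm_num)).differentiableAt (ho.mem_nhds hx)
    have h3 := he.deriv_tangent i
    have h4 := he.hess_tangent i i
    rw [dirDeriv, fderiv_fun_mul hd1 hd2]
    simp only [smul_apply, h3, zero_smul,
      add_zero, smul_eq_mul]
    rw [← dirDeriv, h4, if_pos rfl]
    simp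
  have hl := he.eigenvalue_pos
  have hg := he.norm_pos
  have e1 : ∑ i, dirDeriv (e (.inl i)) (dirDeriv (e (.inl i)) F) x / l i =
      -(N * deriv f (u x)) := by
    have : ∀ i, dirDeriv (e (.inl i)) (dirDeriv (e (.inl i)) F) x / l i = -deriv f (u x) := by
      intro i
      have := (hl i).ne'
      rw [h2]
      field_simp
    simp [this]
  have e2 : ∀ i, dirDeriv (e (.inl i)) F x = 0 := fun i => by
    rw [h1 _ hx]; simp [he.deriv_tangent]
  have e3 : β * dirDeriv (e (.inr ())) F x / g = β * deriv f (u x) := by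
    rw [h1 _ hx]; simp only [he.deriv_normal]; field_simp
  rw [e1, e3]
  simp only [e2, mul_zero, Finset.sum_const_zero]
  have : 0 ≤ 6 * F x * (∑ i, dirDeriv (e (.inl i)) (dirDeriv (e (.inr ())) u) x ^ 2 / l i)
      / g ^ 2 := by
    have : 0 ≤ ∑ i, dirDeriv (e (.inl i)) (dirDeriv (e (.inr ())) u) x ^ 2 / l i :=
      Finset.sum_nonneg fun i _ => div_nonneg (sq_nonneg _) (hl i).le
    positivity
  linarith

/-- The expression is the second derivative at τ = 0 of t³ h along the line (x + τv, 1 + sτ). -/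
theorem IsCubicallyConvexOn.second_order {n : ℕ} {Ω : Set (Eucl n)} {h : Eucl n → ℝ} {x : Eucl n}
    (ho : IsOpen Ω) (hx : x ∈ Ω) (hh : ContDiffOn ℝ 2 h Ω) (hc : IsCubicallyConvexOn Ω h)
    (v : Eucl n) (s : ℝ) :
    0 ≤ dirDeriv v (dirDeriv v h) x + 6 * s * dirDeriv v h x + 6 * s ^ 2 * h x := by
  obtain ⟨r, hr, hball⟩ := Metric.isOpen_iff.mp ho x hx
  have hconv := hc _ hball (convex_ball x r)
  set q : ℝ → ℝ := fun τ => (1 + s * τ) ^ 3 * h (x + τ • v) with hq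
  set q₁ : ℝ → ℝ := fun τ => 3 * s * (1 + s * τ) ^ 2 * h (x + τ • v) +
    (1 + s * τ) ^ 3 * dirDeriv v h (x + τ • v) with hq₁
  have hlin : ∀ τ : ℝ, HasDerivAt (fun τ => 1 + s * τ) s τ := fun τ => by
    simpa using ((hasDerivAt_id τ).const_mul s).const_add 1
  have hd1 : ∀ τ : ℝ, x + τ • v ∈ Ω → HasDerivAt q (q₁ τ) τ := by
    intro τ hτ
    refine (((hlin τ).fun_pow 3).fun_mul
      (hasDerivAt_comp_line (hh.of_le (by norm_num)) ho v hτ)).congr_deriv ?_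
    simp only [hq₁, Nat.cast_ofNat, show 3 - 1 = 2 from rfl]
    ring
  have h0 : x + (0 : ℝ) • v = x := by simp
  have hd2 : HasDerivAt q₁
      (dirDeriv v (dirDeriv v h) x + 6 * s * dirDeriv v h x + 6 * s ^ 2 * h x) 0 := by
    have hτ : x + (0 : ℝ) • v ∈ Ω := by rwa [h0]
    refine (((((hlin 0).fun_pow 2).const_mul (3 * s)).fun_mul
      (hasDerivAt_comp_line (hh.of_le (by norm_num)) ho v hτ)).fun_add
      (((hlin 0).fun_pow 3).fun_mul (hasDerivAt_comp_line
        (hh.dirDeriv ho (by norm_num) v) ho v hτ))).congr_deriv ?_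
    simp
    ring
  have hneg : HasDerivAt (fun τ : ℝ => -τ) (-1) 0 := hasDerivAt_neg 0
  have hmem : ∀ᶠ τ : ℝ in 𝓝 0, x + τ • v ∈ Metric.ball x r ∧ 0 < 1 + s * τ := by
    refine (eventually_line_mem Metric.isOpen_ball (Metric.mem_ball_self hr) v).and ?_
    have : ContinuousAt (fun τ => 1 + s * τ) 0 := (hlin 0).continuousAt
    exact this.eventually (lt_mem_nhds (by simp))
  have hmem' : ∀ᶠ τ : ℝ in 𝓝 0, x + (-τ) • v ∈ Metric.ball x r ∧ 0 < 1 + s * (-τ) := by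
    have : Tendsto (fun τ : ℝ => -τ) (𝓝 0) (𝓝 0) := by simpa using continuous_neg.tendsto (0 : ℝ)
    exact this.eventually hmem
  -- Midpoint convexity makes 0 a minimum of the symmetrized function, so the second derivative test
  -- applies even if q has nonzero slope there.
  have hmin : IsLocalMin (fun τ => q τ + q (-τ)) 0 := by
    filter_upwards [hmem, hmem'] with τ h1 h2
    have m1 : (x + τ • v, 1 + s * τ) ∈ Metric.ball x r ×ˢ Ioi (0 : ℝ) := ⟨h1.1, h1.2⟩
    have m2 : (x + (-τ) • v, 1 + s * (-τ)) ∈ Metric.ball x r ×ˢ Ioi (0 : ℝ) := ⟨h2.1, h2.2⟩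
    have := hconv.2 m1 m2 (by norm_num : (0 : ℝ) ≤ 1 / 2) (by norm_num : (0 : ℝ) ≤ 1 / 2)
      (by norm_num)
    have e1 : (1 / 2 : ℝ) • (x + τ • v, 1 + s * τ) + (1 / 2 : ℝ) • (x + (-τ) • v, 1 + s * (-τ)) =
        (x, 1) := by
      ext1
      · simp only [Prod.fst_add, Prod.smul_fst]; module
      · simp; ring
    rw [e1] at this
    simp only [smul_eq_mul, one_pow, one_mul] at this
    simp only [hq, h0, mul_zero, neg_zero, add_zero, one_pow, one_mul]
    linarith
  have hk1 : ∀ᶠ τ : ℝ in 𝓝 0, HasDerivAt (fun τ => q τ + q (-τ)) (q₁ τ - q₁ (-τ)) τ := by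
    filter_upwards [hmem, hmem'] with τ h1 h2
    refine ((hd1 τ (hball h1.1)).fun_add
      ((hd1 (-τ) (hball h2.1)).comp τ (hasDerivAt_neg τ))).congr_deriv ?_
    ring
  have hk2 := hd2.fun_sub ((show HasDerivAt q₁ _ (-0) by rw [neg_zero]; exact hd2).comp 0 hneg)
  have := (hmin.second_deriv_nonneg hk1 hk2).2
  linarith

/-- For each i, take v = e_i and s = -w_i / g in the second order inequality and divide by l_i. The
sum over i is exactly the negative of the source expression with β = 0. -/
theorem sourceCondition_of_isCubicallyConvexOn {n N : ℕ} {Ω : Set (Eucl n)} {u F h : Eucl n → ℝ}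
    {x : Eucl n} (ho : IsOpen Ω) (hx : x ∈ Ω) (hh : ContDiffOn ℝ 2 h Ω)
    (hc : IsCubicallyConvexOn Ω h) (hF : EqOn F h Ω) : SourceCondition N 0 u F x := by
  intro e l g he
  have hl := he.eigenvalue_pos
  have hg := he.norm_pos
  set w : Fin N → ℝ := fun i => dirDeriv (e (.inl i)) (dirDeriv (e (.inr ())) u) x
  have h1 : ∀ i, 0 ≤ (dirDeriv (e (.inl i)) (dirDeriv (e (.inl i)) F) x
      + 6 * (-(w i / g)) * dirDeriv (e (.inl i)) F x + 6 * (-(w i / g)) ^ 2 * F x) / l i := by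
    intro i
    rw [dirDeriv_congr ho (dirDeriv_congr ho hF _) _ hx, dirDeriv_congr ho hF _ hx, hF hx]
    exact div_nonneg (hc.second_order ho hx hh _ _) (hl i).le
  have h2 := Finset.sum_nonneg fun i (_ : i ∈ Finset.univ) => h1 i
  have h3 : ∑ i, (dirDeriv (e (.inl i)) (dirDeriv (e (.inl i)) F) x
      + 6 * (-(w i / g)) * dirDeriv (e (.inl i)) F x + 6 * (-(w i / g)) ^ 2 * F x) / l i =
      ∑ i, dirDeriv (e (.inl i)) (dirDeriv (e (.inl i)) F) x / l i
      - 6 / g * ∑ i, w i / l i * dirDeriv (e (.inl i)) F x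
      + 6 * F x * (∑ i, w i ^ 2 / l i) / g ^ 2 := by
    rw [Finset.mul_sum, Finset.mul_sum, Finset.sum_div, ← Finset.sum_sub_distrib,
      ← Finset.sum_add_distrib]
    exact Finset.sum_congr rfl fun i _ => by ring
  rw [h3] at h2
  simp only [zero_mul, zero_div, add_zero]
  linarith

/-! ### Continuity up to the boundary and passage to the boundary minimum -/

theorem IsC2UpToBoundary.continuousOn_gradientBar {n : ℕ} {Ω : Set (Eucl n)} {u : Eucl n → ℝ}
    (hu : IsC2UpToBoundary Ω u) : ContinuousOn (gradientBar Ω u) (closure Ω) := by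
  obtain ⟨p, hp, hpu⟩ := hu.gradient_extends
  refine hp.congr fun x hx => extendFrom_eq hx ?_
  exact ((hp x hx).mono subset_closure).tendsto.congr' (hpu.eventuallyEq_nhdsWithin)

theorem IsC2UpToBoundary.continuousOn_hessianBar {n : ℕ} {Ω : Set (Eucl n)} {u : Eucl n → ℝ}
    (hu : IsC2UpToBoundary Ω u) : ContinuousOn (hessianBar Ω u) (closure Ω) := by
  obtain ⟨A, hA, hAu⟩ := hu.hessian_extends
  refine hA.congr fun x hx => extendFrom_eq hx ?_
  exact ((hA x hx).mono subset_closure).tendsto.congr' (hAu.eventuallyEq_nhdsWithin)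

/-- The shape operator acts on a space that varies with x. Written with the bordered determinant in
one fixed basis, K is polynomial in ∇u and D²u, divided by a power of |∇u|. -/
theorem continuousOn_levelCurvature {n N : ℕ} (hn : n = N + 1) {Ω : Set (Eucl n)} {u : Eucl n → ℝ}
    (hu : IsC2UpToBoundary Ω u) :
    ContinuousOn (levelCurvature Ω u) {x ∈ closure Ω | gradientBar Ω u x ≠ 0} := by
  set s := {x ∈ closure Ω | gradientBar Ω u x ≠ 0}
  have hp : ContinuousOn (gradientBar Ω u) s := hu.continuousOn_gradientBar.mono fun x hx => hx.1
  have hA : ContinuousOn (hessianBar Ω u) s := hu.continuousOn_hessianBar.mono fun x hx => hx.1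
  obtain ⟨e⟩ : Nonempty (OrthonormalBasis (Fin N ⊕ Unit) ℝ (Eucl n)) :=
    ⟨(stdOrthonormalBasis ℝ (Eucl n)).reindex (Fintype.equivOfCardEq (by simp [hn]))⟩
  have hdet : ContinuousOn (fun x => (formMatrix (borderedForm (gradientBar Ω u x)
      (hessianBar Ω u x)) (extendedFrame e)).det) s := by
    have : Continuous fun M : Matrix (Fin N ⊕ Fin 2) (Fin N ⊕ Fin 2) ℝ => M.det :=
      continuous_id.matrix_det
    refine this.comp_continuousOn (continuousOn_pi.mpr fun i => continuousOn_pi.mpr fun j => ?_)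
    simp only [formMatrix, borderedForm, Matrix.of_apply, LinearMap.mk₂_apply]
    fun_prop
  have hnorm : ∀ x ∈ s, (-1) ^ (N + 1) * ‖gradientBar Ω u x‖ ^ (N + 2) ≠ 0 := fun x hx =>
    mul_ne_zero (by simp) (pow_ne_zero _ (norm_ne_zero_iff.mpr hx.2))
  refine ContinuousOn.congr (f := fun x => (formMatrix (borderedForm (gradientBar Ω u x)
      (hessianBar Ω u x)) (extendedFrame e)).det /
      ((-1) ^ (N + 1) * ‖gradientBar Ω u x‖ ^ (N + 2))) ?_ fun x hx => ?_
  · exact hdet.div (by fun_prop) hnorm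
  · dsimp only
    rw [det_formMatrix_borderedForm hn hx.2, mul_div_cancel_left₀ _ (hnorm x hx)]
    rfl

/-- A function without interior local minimum that is bounded below approaches its infimum at the
boundary. -/
theorem exists_frontier_frequently_lt {E : Type*} [MetricSpace E] [ProperSpace E] {Ω : Set E}
    (ho : IsOpen Ω) (hne : Ω.Nonempty) (hbd : Bornology.IsBounded Ω) {ψ : E → ℝ}
    (hψ : ContinuousOn ψ Ω) (hbelow : BddBelow (ψ '' Ω)) (hmin : ∀ x ∈ Ω, ¬ IsLocalMin ψ x) :
    ∃ x₀ ∈ frontier Ω, ∀ y ∈ Ω, ∀ ε > 0, ∃ᶠ x in 𝓝[Ω] x₀, ψ x < ψ y + ε := by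
  obtain ⟨v, -, hv, hvm⟩ := exists_seq_tendsto_sInf (hne.image ψ) hbelow
  choose x hxΩ hxv using hvm
  have hcomp : IsCompact (closure Ω) := hbd.isCompact_closure
  obtain ⟨x₀, hx₀, k, hk, hlim⟩ := hcomp.tendsto_subseq fun i => subset_closure (hxΩ i)
  have hψlim : Tendsto (fun i => ψ (x (k i))) atTop (𝓝 (sInf (ψ '' Ω))) := by
    simpa only [hxv, Function.comp_def] using hv.comp hk.tendsto_atTop
  have hlim' : Tendsto (fun i => x (k i)) atTop (𝓝[Ω] x₀) :=
    tendsto_nhdsWithin_iff.mpr ⟨hlim, Eventually.of_forall fun i => hxΩ _⟩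
  refine ⟨x₀, ⟨hx₀, fun hint => ?_⟩, fun y hy ε hε => ?_⟩
  · rw [ho.interior_eq] at hint
    have heq : ψ x₀ = sInf (ψ '' Ω) := tendsto_nhds_unique ((hψ x₀ hint).tendsto.comp hlim') hψlim
    refine hmin x₀ hint ?_
    filter_upwards [ho.mem_nhds hint] with z hz
    rw [heq]
    exact csInf_le hbelow (mem_image_of_mem ψ hz)
  · have hlt : sInf (ψ '' Ω) < ψ y + ε :=
      (csInf_le hbelow (mem_image_of_mem ψ hy)).trans_lt (lt_add_of_pos_right _ hε)
    exact hlim'.frequently (hψlim.eventually (gt_mem_nhds hlt)).frequently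

/-- The minimum principle for `ρ(|∇u|) K`, where `ρ(r)` is the power `r ^ (N + β)`. -/
theorem attainsMinOnBoundary_of_sourceCondition {n N : ℕ} (hn : n = N + 1) (hN : 1 ≤ N)
    {Ω : Set (Eucl n)} {u F : Eucl n → ℝ} (hΩ : IsSmoothBoundedDomain Ω)
    (hu : ContDiffOn ℝ 4 u Ω) (hu2 : IsC2UpToBoundary Ω u) (hlap : ∀ x ∈ Ω, (Δ u) x = F x)
    (hF0 : ∀ x ∈ Ω, 0 ≤ F x) (hgrad : ∀ x ∈ Ω, ∇ u x ≠ 0)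
    (hconv : ∀ x ∈ Ω, IsStrictlyConvexLevel (∇ u x) (hessian u x)) {β : ℝ}
    (hβ : β = 0 ∨ β = -(N + 2)) (hsrc : ∀ x ∈ Ω, SourceCondition N β u F x) {ρ : ℝ → ℝ}
    (hρ : ContinuousOn ρ (Ioi 0))
    (hρlog : ∀ r > 0, 0 < ρ r ∧ Real.log (ρ r) = (N + β) * Real.log r) :
    AttainsMinOnBoundary Ω u (fun x => ρ ‖gradientBar Ω u x‖ * levelCurvature Ω u x) := by
  set ψ : Eucl n → ℝ := fun x => ρ ‖gradientBar Ω u x‖ * levelCurvature Ω u x with hψdef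
  have ho := hΩ.isOpen
  set s := {x ∈ closure Ω | gradientBar Ω u x ≠ 0}
  have hbar : ∀ x ∈ Ω, gradientBar Ω u x = ∇ u x ∧ hessianBar Ω u x = hessian u x := fun x hx =>
    gradientBar_hessianBar_eq ho hu2.contDiffOn hx
  have hΩs : Ω ⊆ s := fun x hx => ⟨subset_closure hx, by rw [(hbar x hx).1]; exact hgrad x hx⟩
  have hcont : ContinuousOn ψ s := by
    refine ContinuousOn.mul (hρ.comp (hu2.continuousOn_gradientBar.mono fun x hx => hx.1).norm
      fun x hx => norm_pos_iff.mpr hx.2) (continuousOn_levelCurvature hn hu2)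
  have hψ : ∀ x ∈ Ω, 0 < ψ x ∧ Real.log (ψ x) = (N + β) * Real.log ‖∇ u x‖ +
      Real.log (LinearMap.det (shapeOperator (∇ u x) (hessian u x))) := by
    intro x hx
    obtain ⟨-, -, -, hK⟩ := exists_isPrincipalFrame hn hu2.contDiffOn ho hx (hgrad x hx)
      (hconv x hx)
    obtain ⟨hρ0, hρl⟩ := hρlog _ (norm_pos_iff.mpr (hgrad x hx))
    have hlc : levelCurvature Ω u x = LinearMap.det (shapeOperator (∇ u x) (hessian u x)) := by
      rw [levelCurvature, (hbar x hx).1, (hbar x hx).2]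
    simp only [hψdef, hlc, (hbar x hx).1]
    exact ⟨mul_pos hρ0 hK, by rw [Real.log_mul hρ0.ne' hK.ne', hρl]⟩
  have hbelow : BddBelow (ψ '' Ω) := ⟨0, by rintro _ ⟨x, hx, rfl⟩; exact (hψ x hx).1.le⟩
  obtain ⟨x₀, hx₀, hfreq⟩ := exists_frontier_frequently_lt ho hΩ.isConnected.nonempty
    hΩ.isBounded (hcont.mono hΩs) hbelow fun x hx =>
    not_isLocalMin_of_log_eq hn hN ho hx hu hlap (hF0 x hx) hgrad hconv hβ (hsrc x hx) hψ
  refine ⟨x₀, hx₀, hfreq, fun hp y hy hpy => ?_⟩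
  have hlim : ∀ z ∈ closure Ω, gradientBar Ω u z ≠ 0 → Tendsto ψ (𝓝[Ω] z) (𝓝 (ψ z)) :=
    fun z hz hpz => (hcont z ⟨hz, hpz⟩).mono hΩs
  -- Where ∇u (x₀) ≠ 0 the function is continuous at x₀ from inside Ω, so the lower limit there is
  -- the value itself.
  have hle : ∀ z ∈ Ω, ψ x₀ ≤ ψ z := by
    intro z hz
    refine le_of_forall_pos_le_add fun ε hε => ?_
    by_contra! hlt
    obtain ⟨x, hx1, hx2⟩ := ((hfreq z hz ε hε).and_eventually
      ((hlim x₀ hx₀.1 hp).eventually (lt_mem_nhds hlt))).exists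
    exact lt_asymm hx1 hx2
  have : (𝓝[Ω] y).NeBot := mem_closure_iff_nhdsWithin_neBot.mp hy
  exact ge_of_tendsto (hlim y hy hpy) (eventually_mem_nhdsWithin.mono hle)

/-! ### Convexity of t³ h and concavity of h^(-1/2) -/

theorem rpow_neg_half_sq {r : ℝ} (hr : 0 < r) : (r ^ (-(1 / 2) : ℝ)) ^ 2 = r⁻¹ := by
  rw [← Real.rpow_natCast, ← Real.rpow_mul hr.le]
  norm_num
  exact Real.rpow_neg_one r

/-- Joint convexity of `(t, k) ↦ t³ / k²` for `t, k > 0`. -/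
theorem cube_div_sq_convex {t₁ t₂ k₁ k₂ a b : ℝ} (ht₁ : 0 < t₁) (ht₂ : 0 < t₂) (hk₁ : 0 < k₁)
    (hk₂ : 0 < k₂) (ha : 0 ≤ a) (hb : 0 ≤ b) (hab : a + b = 1) :
    (a * t₁ + b * t₂) ^ 3 / (a * k₁ + b * k₂) ^ 2 ≤ a * (t₁ ^ 3 / k₁ ^ 2) + b * (t₂ ^ 3 / k₂ ^ 2) := by
  have hpos : ∀ p q : ℝ, 0 < p → 0 < q → 0 < a * p + b * q := by
    intro p q hp hq
    rcases ha.eq_or_lt with rfl | ha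
    · obtain rfl : b = 1 := by linarith
      linarith
    · exact add_pos_of_pos_of_nonneg (mul_pos ha hp) (mul_nonneg hb hq.le)
  have hK := hpos k₁ k₂ hk₁ hk₂
  have hT := hpos t₁ t₂ ht₁ ht₂
  set K := a * k₁ + b * k₂
  set T := a * t₁ + b * t₂
  -- the tangent inequality `t³ / k² ≥ 3 m² t - 2 m³ k` with `m = T / K`
  have htan : ∀ t k : ℝ, 0 < t → 0 < k →
      3 * (T / K) ^ 2 * t - 2 * (T / K) ^ 3 * k ≤ t ^ 3 / k ^ 2 := by
    intro t k ht hk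
    have hm : 0 < T / K := div_pos hT hK
    generalize T / K = m at hm
    rw [le_div_iff₀ (by positivity)]
    have : 0 ≤ (t - m * k) ^ 2 * (t + 2 * m * k) := by positivity
    linarith [this, show t ^ 3 - (3 * m ^ 2 * t - 2 * m ^ 3 * k) * k ^ 2 =
      (t - m * k) ^ 2 * (t + 2 * m * k) by ring]
  have h1 := mul_le_mul_of_nonneg_left (htan t₁ k₁ ht₁ hk₁) ha
  have h2 := mul_le_mul_of_nonneg_left (htan t₂ k₂ ht₂ hk₂) hb
  have h3 : a * (3 * (T / K) ^ 2 * t₁ - 2 * (T / K) ^ 3 * k₁) +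
      b * (3 * (T / K) ^ 2 * t₂ - 2 * (T / K) ^ 3 * k₂) = T ^ 3 / K ^ 2 := by
    have : a * (3 * (T / K) ^ 2 * t₁ - 2 * (T / K) ^ 3 * k₁) +
      b * (3 * (T / K) ^ 2 * t₂ - 2 * (T / K) ^ 3 * k₂) =
      3 * (T / K) ^ 2 * T - 2 * (T / K) ^ 3 * K := by simp only [T, K]; ring
    rw [this]
    field_simp
    ring
  linarith

/-- With k = h^(-1/2) the function is t³ / k², jointly convex in (t, k) and decreasing in k, so
concavity of k suffices. Conversely, at t = k(x) and t = k(y) the values are k(x) and k(y). If S is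
their convex combination and z the value of k at the combined point, convexity says S³ / z² ≤ S,
that is, S ≤ z. -/
theorem isCubicallyConvexOn_iff_isConcaveInvSqrtOn {n : ℕ} {Ω : Set (Eucl n)} {h : Eucl n → ℝ}
    (hh : ∀ x ∈ Ω, 0 < h x) : IsCubicallyConvexOn Ω h ↔ IsConcaveInvSqrtOn Ω h := by
  set k : Eucl n → ℝ := fun x => h x ^ (-(1 / 2) : ℝ) with hk
  have hkpos : ∀ x ∈ Ω, 0 < k x := fun x hx => Real.rpow_pos_of_pos (hh x hx) _
  have hksq : ∀ x ∈ Ω, h x = 1 / k x ^ 2 := fun x hx => by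
    rw [hk, rpow_neg_half_sq (hh x hx), one_div, inv_inv]
  refine forall₃_congr fun C hCΩ hC => ⟨fun hc => ⟨hC, fun x hx y hy a b ha hb hab => ?_⟩,
    fun hc => ⟨hC.prod (convex_Ioi 0), ?_⟩⟩
  · have hz := hC hx hy ha hb hab
    have hkx := hkpos x (hCΩ hx)
    have hky := hkpos y (hCΩ hy)
    have hkz := hkpos _ (hCΩ hz)
    have m1 : (x, k x) ∈ C ×ˢ Ioi (0 : ℝ) := ⟨hx, hkx⟩
    have m2 : (y, k y) ∈ C ×ˢ Ioi (0 : ℝ) := ⟨hy, hky⟩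
    have h1 := hc.2 m1 m2 ha hb hab
    simp only [Prod.fst_add, Prod.smul_fst, Prod.snd_add, Prod.smul_snd, smul_eq_mul] at h1
    rw [hksq x (hCΩ hx), hksq y (hCΩ hy), hksq _ (hCΩ hz)] at h1
    have hs : 0 < a * k x + b * k y := (convex_Ioi (0 : ℝ)) hkx hky ha hb hab
    change a * k x + b * k y ≤ k (a • x + b • y)
    generalize k (a • x + b • y) = z at h1 hkz
    have e1 : a * (k x ^ 3 * (1 / k x ^ 2)) + b * (k y ^ 3 * (1 / k y ^ 2)) = a * k x + b * k y := by
      field_simp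
    rw [e1, mul_one_div, div_le_iff₀ (by positivity)] at h1
    have h2 : (a * k x + b * k y) ^ 2 ≤ z ^ 2 :=
      le_of_mul_le_mul_left (by linarith [h1, pow_succ' (a * k x + b * k y) 2]) hs
    exact le_of_sq_le_sq h2 hkz.le
  · rintro ⟨x, t₁⟩ ⟨hx, ht₁⟩ ⟨y, t₂⟩ ⟨hy, ht₂⟩ a b ha hb hab
    have hz := hC hx hy ha hb hab
    have hkx := hkpos x (hCΩ hx)
    have hky := hkpos y (hCΩ hy)
    simp only [mem_Ioi] at ht₁ ht₂ hx hy
    have hkz : a * k x + b * k y ≤ k (a • x + b • y) := hc.2 hx hy ha hb hab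
    have hs : 0 < a * k x + b * k y := (convex_Ioi (0 : ℝ)) hkx hky ha hb hab
    have hT : 0 < a * t₁ + b * t₂ := (convex_Ioi (0 : ℝ)) ht₁ ht₂ ha hb hab
    simp only [Prod.fst_add, Prod.smul_fst, Prod.snd_add, Prod.smul_snd, smul_eq_mul]
    rw [hksq x (hCΩ hx), hksq y (hCΩ hy), hksq _ (hCΩ hz), mul_one_div, mul_one_div, mul_one_div]
    refine le_trans ?_ (cube_div_sq_convex ht₁ ht₂ hkx hky ha hb hab)
    gcongr

/-! ### The theorem -/

theorem theorem1p3 (n : ℕ) (hn : 2 ≤ n) (Ω : Set (Eucl n)) (hΩ : IsSmoothBoundedDomain Ω)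
    (u : Eucl n → ℝ) (hu4 : ContDiffOn ℝ 4 u Ω) (hu2 : IsC2UpToBoundary Ω u)
    (f : Eucl n → ℝ → ℝ)
    (hf : ContDiffOn ℝ 2 (fun q : Eucl n × ℝ => f q.1 q.2) (Ω ×ˢ Set.univ))
    (hf0 : ∀ x ∈ Ω, ∀ t : ℝ, 0 ≤ f x t)
    (hsol : ∀ x ∈ Ω, (Δ u) x = f x (u x))
    (hgrad : ∀ x ∈ Ω, ∇ u x ≠ 0)
    (hconv : ∀ x ∈ Ω, IsStrictlyConvexLevel (∇ u x) (hessian u x)) :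
    -- (ia)
    (∀ g : ℝ → ℝ, (∀ x ∈ Ω, ∀ t : ℝ, f x t = g t) → (∀ t : ℝ, 0 ≤ deriv g t) →
      AttainsMinOnBoundary Ω u
        (fun x => (‖gradientBar Ω u x‖ ^ 2)⁻¹ * levelCurvature Ω u x)) ∧
    -- (ib)
    (∀ g : ℝ → ℝ, (∀ x ∈ Ω, ∀ t : ℝ, f x t = g t) → (∀ t : ℝ, deriv g t ≤ 0) →
      AttainsMinOnBoundary Ω u
        (fun x => ‖gradientBar Ω u x‖ ^ (n - 1) * levelCurvature Ω u x)) ∧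
    -- (ii)
    (∀ h : Eucl n → ℝ, (∀ x ∈ Ω, ∀ t : ℝ, f x t = h x) →
      (IsCubicallyConvexOn Ω h → AttainsMinOnBoundary Ω u
        (fun x => ‖gradientBar Ω u x‖ ^ (n - 1) * levelCurvature Ω u x)) ∧
      ((∀ x ∈ Ω, 0 < h x) → (IsCubicallyConvexOn Ω h ↔ IsConcaveInvSqrtOn Ω h))) := by
  obtain ⟨N, rfl⟩ : ∃ N, n = N + 1 := ⟨n - 1, by omega⟩
  have hN : 1 ≤ N := by omega
  have ho := hΩ.isOpen
  have hF0 : ∀ x ∈ Ω, 0 ≤ f x (u x) := fun x hx => hf0 x hx _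
  obtain ⟨z, hz⟩ := hΩ.isConnected.nonempty
  have hu : ContDiffOn ℝ 2 u Ω := hu2.contDiffOn
  have hg2 : ∀ g : ℝ → ℝ, (∀ x ∈ Ω, ∀ t : ℝ, f x t = g t) → ContDiff ℝ 2 g := by
    intro g hg
    have h1 : ContDiffOn ℝ 2 (fun t : ℝ => f z t) univ :=
      hf.comp (f := fun t : ℝ => (z, t)) (by fun_prop) fun t _ => ⟨hz, mem_univ _⟩
    have h2 : g = fun t => f z t := funext fun t => (hg z hz t).symm
    rw [h2]
    exact contDiffOn_univ.mp h1
  have hpow : ContinuousOn (fun r : ℝ => r ^ N) (Ioi 0) := (continuous_pow N).continuousOn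
  have hpowlog : ∀ r : ℝ, r > 0 → 0 < r ^ N ∧ Real.log (r ^ N) = (N + 0) * Real.log r :=
    fun r hr => ⟨pow_pos hr N, by rw [Real.log_pow, add_zero]⟩
  refine ⟨fun g hg hg' => ?_, fun g hg hg' => ?_, fun h hh => ⟨fun hc => ?_, fun hpos =>
    isCubicallyConvexOn_iff_isConcaveInvSqrtOn hpos⟩⟩
  -- Here β = -(N+2), so the exponent N + β is -2 and the source condition asks for -2 f' ≤ 0. The
  -- other two cases take β = 0, with exponent N = n - 1.
  · refine attainsMinOnBoundary_of_sourceCondition rfl hN hΩ hu4 hu2 hsol hF0 hgrad hconv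
      (Or.inr rfl) (fun x hx => sourceCondition_of_comp ho hx hu (hg2 g hg)
        (fun y hy => hg y hy _) (hF0 x hx) ?_) (ρ := fun r => (r ^ 2)⁻¹) ?_ fun r hr => ⟨?_, ?_⟩
    · nlinarith [hg' (u x)]
    · exact (continuous_pow 2).continuousOn.inv₀ fun r hr => (pow_pos hr 2).ne'
    · positivity
    · rw [Real.log_inv, Real.log_pow]
      push_cast
      ring
  · refine attainsMinOnBoundary_of_sourceCondition rfl hN hΩ hu4 hu2 hsol hF0 hgrad hconv
      (Or.inl rfl) (fun x hx => sourceCondition_of_comp ho hx hu (hg2 g hg)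
        (fun y hy => hg y hy _) (hF0 x hx) ?_) hpow hpowlog
    rw [add_zero]
    exact mul_nonpos_of_nonneg_of_nonpos (Nat.cast_nonneg N) (hg' _)
  · have hh2 : ContDiffOn ℝ 2 h Ω := by
      have h1 : ContDiffOn ℝ 2 (fun x : Eucl (N + 1) => f x 0) Ω :=
        hf.comp (f := fun x => (x, (0 : ℝ))) (by fun_prop) fun x hx => ⟨hx, mem_univ _⟩
      exact h1.congr fun x hx => (hh x hx 0).symm
    exact attainsMinOnBoundary_of_sourceCondition rfl hN hΩ hu4 hu2 hsol hF0 hgrad hconv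
      (Or.inl rfl) (fun x hx => sourceCondition_of_isCubicallyConvexOn ho hx hh2 hc
        fun y hy => hh y hy _) hpow hpowlog
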